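/- Let $\mathbf k$ be a field, $Z$ a well-ordered set, $\mathcal S(Z)$ the free semigroup on $Z$ and $\mathcal M(Z)=\mathcal S(Z)\sqcup\{1\}$ the free monoid. Let $A=\mathbf k\mathcal S(Z)/I_A$ be a nonunital associative algebra, and let $G\subseteq\mathbf k\mathcal S(Z)$ be a Gröbner–Shirshov (GS) basis of the ideal $I_A$ with respect to the degree lexicographical order. For $0\neq g\in G$ let $\bar g$ be its leading monomial, and put $$\mathrm{Irr}_{\mathcal M}(G)=\mathcal M(Z)\setminus\{u\bar g v : 0\ne g\in G,\ u,v\in\mathcal M(Z)\},\qquad \mathrm{Irr}_{\mathcal S}(G)=\mathrm{Irr}_{\mathcal M}(G)\cap\mathcal S(Z).$$ Let $\mathfrak S(Z)$ be the free operated semigroup on $Z$, with operator $u\mapsto\lfloor u\rfloor$: its elements are the nonempty words whose letters are elements of $Z$ or brackets $\lfloor w\rfloor$ of such words. Write $\lfloor u\rfloor^{(1)}=\lfloor u\rfloor$ and $\lfloor u\rfloor^{(k+1)}=\lfloor\lfloor u\rfloor^{(k)}\rfloor$ for $k\ge1$. An operated algebra is a nonunital $\mathbf k$-algebra $B$ with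 a $\mathbf k$-linear map $\lfloor\cdot\rfloor:B\to B$. For $\phi(x,y)\in\mathbf k\mathfrak S(\{x,y\})$, it is a $\phi$-algebra if $\phi(r,s)=0$ for all $r,s\in B$. The free $\phi$-algebra over $A$ is $$\mathcal F^{\phi}(A)=\mathbf k\mathfrak S(Z)\big/\big\langle \{\phi(u,v): u,v\in\mathfrak S(Z)\}\cup I_A\big\rangle,$$ the quotient by the generated operated ideal (the smallest two-sided ideal that contains these elements and is stable under the operator). For every $\phi$ occurring in (a), (b), (c) below it has, with the canonical homomorphism $A\to\mathcal F^{\phi}(A)$, the universal property: every algebra homomorphism from $A$ to a $\phi$-algebra factors uniquely through a homomorphism of operated algebras from $\mathcal F^{\phi}(A)$. A set of words in $\mathfrak S(Z)$ is called a linear basis of $\mathcal F^\phi(A)$ if the family of the classes of these words is a $\mathbf k$-basis. Then the following hold. (a) Let $\phi_1$ be $\lfloor x\rfloor\lfloor y\rfloor-\lambda(x\lfloor y\rfloor+\lfloor x\rfloor y)+\mu\lfloor xy\rfloor+\nu xy$ with $\lambda,\mu,\nu\in\mathbf k$, $\lambda^2=\lambda\mu+\nu$, or $\lfloor x\rfloor\lfloor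 y\rfloor-\lambda(x\lfloor y\rfloor+\lfloor x\rfloor y)+\mu\lfloor yx\rfloor+\lambda^2xy-\lambda\mu yx$ with $\lambda,\mu\in\mathbf k$. Put $B_0=\mathrm{Irr}_{\mathcal S}(G)$ and, for $n\ge1$, $$B_n=B_0\cup\bigcup_{r\ge1}\big\{u_0\lfloor v_1\rfloor u_1\cdots\lfloor v_r\rfloor u_r : u_0,u_r\in\mathrm{Irr}_{\mathcal M}(G),\ u_i\in\mathrm{Irr}_{\mathcal S}(G)\ (1\le i\le r-1),\ v_j\in B_{n-1}\ (1\le j\le r)\big\}.$$ Then $B=\bigcup_{n\ge0}B_n$ is a linear basis of $\mathcal F^{\phi_1}(A)$. (b) Let $\phi_2$ be $x\lfloor y\rfloor-\lfloor xy\rfloor+\lfloor x\rfloor y-\lambda xy$ with $\lambda\in\mathbf k$, or $x\lfloor y\rfloor-\lfloor xy\rfloor$. Then the union of $\mathrm{Irr}_{\mathcal S}(G)$ with $$\bigcup_{r\ge1}\big\{\lfloor\lfloor\cdots\lfloor\lfloor u_r\rfloor^{(k_r)}u_{r-1}\rfloor^{(k_{r-1})}\cdots u_1\rfloor^{(k_1)}u_0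 : u_0\in\mathrm{Irr}_{\mathcal M}(G),\ u_i\in\mathrm{Irr}_{\mathcal S}(G),\ k_i\ge1\ (1\le i\le r)\big\}$$ is a linear basis of $\mathcal F^{\phi_2}(A)$. (c) Let $\phi_3$ be $\lfloor x\rfloor y-\lfloor xy\rfloor$. Then the union of $\mathrm{Irr}_{\mathcal S}(G)$ with $$\bigcup_{r\ge1}\big\{u_0\lfloor u_1\cdots\lfloor u_{r-1}\lfloor u_r\rfloor^{(k_r)}\rfloor^{(k_{r-1})}\cdots\rfloor^{(k_1)} : u_0\in\mathrm{Irr}_{\mathcal M}(G),\ u_i\in\mathrm{Irr}_{\mathcal S}(G),\ k_i\ge1\ (1\le i\le r)\big\}$$ is a linear basis of $\mathcal F^{\phi_3}(A)$. -/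

import Mathlib

universe u v w

namespace OpAlg

/-! ### Ideals and quotients of nonunital associative algebras -/

section Ideals

variable {k : Type u} {R : Type v} [Field k] [NonUnitalRing R] [Module k R]

variable (k R) in
/-- A two-sided ideal of a nonunital `k`-algebra (in particular a `k`-subspace). -/
structure AlgIdeal extends Submodule k R where
  mul_mem_left : ∀ (r : R) {x : R}, x ∈ toSubmodule → r * x ∈ toSubmodule
  mul_mem_right : ∀ (r : R) {x : R}, x ∈ toSubmodule → x * r ∈ toSubmodule

/-- The subspace `I` is a two-sided ideal. -/
def IsAlgIdeal (I : Submodule k R) : Prop :=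
  (∀ (r : R), ∀ x ∈ I, r * x ∈ I) ∧ (∀ (r : R), ∀ x ∈ I, x * r ∈ I)

/-- The ideal generated by a subset. -/
def AlgIdeal.span (S : Set R) : AlgIdeal k R where
  toSubmodule := sInf {I : Submodule k R | IsAlgIdeal I ∧ S ⊆ I}
  mul_mem_left r x hx := by
    rw [Submodule.mem_sInf] at hx ⊢
    exact fun I hI => hI.1.1 r x (hx I hI)
  mul_mem_right r x hx := by
    rw [Submodule.mem_sInf] at hx ⊢
    exact fun I hI => hI.1.2 r x (hx I hI)

/-- The operated ideal of the operated algebra `(R, P)` generated by a subset: the smallest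
two-sided ideal which contains the subset and is stable under `P`. -/
def AlgIdeal.operatedSpan (P : R →ₗ[k] R) (S : Set R) : AlgIdeal k R where
  toSubmodule := sInf {I : Submodule k R | IsAlgIdeal I ∧ (∀ x ∈ I, P x ∈ I) ∧ S ⊆ I}
  mul_mem_left r x hx := by
    rw [Submodule.mem_sInf] at hx ⊢
    exact fun I hI => hI.1.1 r x (hx I hI)
  mul_mem_right r x hx := by
    rw [Submodule.mem_sInf] at hx ⊢
    exact fun I hI => hI.1.2 r x (hx I hI)

theorem AlgIdeal.subset_operatedSpan (P : R →ₗ[k] R) (S : Set R) :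
    S ⊆ (AlgIdeal.operatedSpan P S).toSubmodule := fun _ hx =>
  (Submodule.mem_sInf).2 fun _ hI => hI.2.2 hx

theorem AlgIdeal.operatedSpan_stable (P : R →ₗ[k] R) (S : Set R) {x : R}
    (hx : x ∈ (AlgIdeal.operatedSpan P S).toSubmodule) :
    P x ∈ (AlgIdeal.operatedSpan P S).toSubmodule :=
  (Submodule.mem_sInf).2 fun I hI => hI.2.1 x ((Submodule.mem_sInf).1 hx I hI)

/-- The quotient algebra `R / I`. -/
def AlgIdeal.Quot (I : AlgIdeal k R) : Type v := R ⧸ I.toSubmodule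

variable (I : AlgIdeal k R)

instance : AddCommGroup I.Quot := inferInstanceAs (AddCommGroup (R ⧸ I.toSubmodule))

instance : Module k I.Quot := inferInstanceAs (Module k (R ⧸ I.toSubmodule))

/-- The class of an element in the quotient algebra. -/
def AlgIdeal.toQuot : R →ₗ[k] I.Quot := I.toSubmodule.mkQ

theorem AlgIdeal.toQuot_surjective : Function.Surjective I.toQuot := Submodule.mkQ_surjective _

theorem AlgIdeal.toQuot_eq_iff {x y : R} : I.toQuot x = I.toQuot y ↔ x - y ∈ I.toSubmodule :=
  Submodule.Quotient.eq _

instance : Mul I.Quot where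
  mul := Quotient.map₂ (· * ·) (by
    intro a a' ha b b' hb
    have ha' : a - a' ∈ I.toSubmodule := (Submodule.quotientRel_def _).1 ha
    have hb' : b - b' ∈ I.toSubmodule := (Submodule.quotientRel_def _).1 hb
    refine (Submodule.quotientRel_def _).2 ?_
    have h : a * b - a' * b' = (a - a') * b + a' * (b - b') := by noncomm_ring
    rw [h]
    exact I.toSubmodule.add_mem (I.mul_mem_right b ha') (I.mul_mem_left a' hb'))

theorem AlgIdeal.toQuot_mul (x y : R) : I.toQuot (x * y) = I.toQuot x * I.toQuot y := rfl

instance : NonUnitalRing I.Quot :=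
  { (inferInstance : AddCommGroup I.Quot), (inferInstance : Mul I.Quot) with
    left_distrib := by
      intro a b c
      obtain ⟨a, rfl⟩ := I.toQuot_surjective a
      obtain ⟨b, rfl⟩ := I.toQuot_surjective b
      obtain ⟨c, rfl⟩ := I.toQuot_surjective c
      change I.toQuot a * (I.toQuot b + I.toQuot c) = I.toQuot a * I.toQuot b + I.toQuot a * I.toQuot c
      simp only [← map_add, ← AlgIdeal.toQuot_mul, mul_add]
    right_distrib := by
      intro a b c
      obtain ⟨a, rfl⟩ := I.toQuot_surjective a
      obtain ⟨b, rfl⟩ := I.toQuot_surjective b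
      obtain ⟨c, rfl⟩ := I.toQuot_surjective c
      change (I.toQuot a + I.toQuot b) * I.toQuot c = I.toQuot a * I.toQuot c + I.toQuot b * I.toQuot c
      simp only [← map_add, ← AlgIdeal.toQuot_mul, add_mul]
    zero_mul := by
      intro a
      obtain ⟨a, rfl⟩ := I.toQuot_surjective a
      change (0 : I.Quot) * I.toQuot a = 0
      rw [← map_zero I.toQuot, ← AlgIdeal.toQuot_mul, zero_mul]
    mul_zero := by
      intro a
      obtain ⟨a, rfl⟩ := I.toQuot_surjective a
      change I.toQuot a * (0 : I.Quot) = 0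
      rw [← map_zero I.toQuot, ← AlgIdeal.toQuot_mul, mul_zero]
    mul_assoc := by
      intro a b c
      obtain ⟨a, rfl⟩ := I.toQuot_surjective a
      obtain ⟨b, rfl⟩ := I.toQuot_surjective b
      obtain ⟨c, rfl⟩ := I.toQuot_surjective c
      change I.toQuot a * I.toQuot b * I.toQuot c = I.toQuot a * (I.toQuot b * I.toQuot c)
      simp only [← AlgIdeal.toQuot_mul, mul_assoc] }

instance [IsScalarTower k R R] : IsScalarTower k I.Quot I.Quot where
  smul_assoc c a b := by
    obtain ⟨a, rfl⟩ := I.toQuot_surjective a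
    obtain ⟨b, rfl⟩ := I.toQuot_surjective b
    change (c • I.toQuot a) * I.toQuot b = c • (I.toQuot a * I.toQuot b)
    rw [← map_smul, ← AlgIdeal.toQuot_mul, ← AlgIdeal.toQuot_mul, ← map_smul, smul_mul_assoc]

instance [SMulCommClass k R R] : SMulCommClass k I.Quot I.Quot where
  smul_comm c a b := by
    obtain ⟨a, rfl⟩ := I.toQuot_surjective a
    obtain ⟨b, rfl⟩ := I.toQuot_surjective b
    change c • (I.toQuot a * I.toQuot b) = I.toQuot a * (c • I.toQuot b)
    rw [← map_smul, ← AlgIdeal.toQuot_mul, ← AlgIdeal.toQuot_mul, ← map_smul, mul_smul_comm]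

/-- The operator induced on a quotient by an ideal which is stable under the operator `P`. -/
def AlgIdeal.quotOperator (P : R →ₗ[k] R)
    (hP : ∀ x ∈ I.toSubmodule, P x ∈ I.toSubmodule) : I.Quot →ₗ[k] I.Quot :=
  Submodule.mapQ I.toSubmodule I.toSubmodule P hP

/-- The algebra homomorphism `R / I → R' / I'` induced by `f : R → R'` with `f(I) ⊆ I'`. -/
def AlgIdeal.quotMap {R' : Type w} [NonUnitalRing R'] [Module k R'] (I' : AlgIdeal k R')
    (f : R →ₙₐ[k] R') (hf : ∀ x ∈ I.toSubmodule, f x ∈ I'.toSubmodule) :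
    I.Quot →ₙₐ[k] I'.Quot :=
  let g : I.Quot →ₗ[k] I'.Quot :=
    Submodule.mapQ I.toSubmodule I'.toSubmodule (f : R →ₗ[k] R') hf
  { toFun := g
    map_smul' := g.map_smul
    map_zero' := g.map_zero
    map_add' := g.map_add
    map_mul' := by
      intro a b
      obtain ⟨a, rfl⟩ := I.toQuot_surjective a
      obtain ⟨b, rfl⟩ := I.toQuot_surjective b
      change I'.toQuot (f (a * b)) = I'.toQuot (f a) * I'.toQuot (f b)
      rw [map_mul, AlgIdeal.toQuot_mul] }

end Ideals

/-! ### The free operated semigroup -/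

/-- The free operated semigroup on `Z`: the nonempty words in letters which are either elements
of `Z` or brackets `⌊w⌋` of such words. A word is given by its first letter (an element of `Z`
or a bracket), followed by nothing or by a further word. -/
inductive BWord (Z : Type u) : Type u
  | var : Z → BWord Z
  | br : BWord Z → BWord Z
  | varCons : Z → BWord Z → BWord Z
  | brCons : BWord Z → BWord Z → BWord Z

namespace BWord

variable {Z : Type u}

/-- Concatenation of words. -/
def append : BWord Z → BWord Z → BWord Z
  | var z, t => varCons z t
  | br s, t => brCons s t
  | varCons z s, t => varCons z (append s t)
  | brCons s s', t => brCons s (append s' t)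

instance : Mul (BWord Z) := ⟨append⟩

instance : Semigroup (BWord Z) where
  mul_assoc a b c := by
    change append (append a b) c = append a (append b c)
    induction a with
    | var z => rfl
    | br s _ => rfl
    | varCons z s ih => simp only [append, ih]
    | brCons s s' _ ih => simp only [append, ih]

/-- The inclusion of the free semigroup on `Z` into the free operated semigroup on `Z`. -/
def ofWord : FreeSemigroup Z →ₙ* BWord Z := FreeSemigroup.lift var

/-- The extension of `ofWord` to the empty word. -/
def ofWordM : WithOne (FreeSemigroup Z) →* WithOne (BWord Z) := WithOne.mapMulHom ofWord

/-- The value of a word in a semigroup with an operator `P`, when each `z : Z` is replaced by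
`r z`. -/
def eval {C : Type v} [Mul C] (P : C → C) (r : Z → C) : BWord Z → C
  | var z => r z
  | br s => P (eval P r s)
  | varCons z s => r z * eval P r s
  | brCons s s' => P (eval P r s) * eval P r s'

end BWord

/-! ### Free operated algebras and operated polynomial identities -/

section Operated

variable (k : Type u) [Field k] (Z : Type v)

/-- The semigroup algebra of the free semigroup, i.e. the free nonunital algebra on `Z`. -/
abbrev WordAlg := MonoidAlgebra k (FreeSemigroup Z)

/-- The semigroup algebra of the free operated semigroup, i.e. the free nonunital operated
algebra on `Z`. -/
abbrev BWordAlg := MonoidAlgebra k (BWord Z)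

variable {Z} in
/-- A word as an element of the free nonunital operated algebra. -/
noncomputable def mono (s : BWord Z) : BWordAlg k Z := MonoidAlgebra.single s 1

/-- The operator of the free nonunital operated algebra: the linear extension of `s ↦ ⌊s⌋`. -/
noncomputable def brOp : BWordAlg k Z →ₗ[k] BWordAlg k Z :=
  MonoidAlgebra.mapDomainLinearMap k k BWord.br

/-- The inclusion of the free nonunital algebra into the free nonunital operated algebra. -/
noncomputable def incl : WordAlg k Z →ₙₐ[k] BWordAlg k Z :=
  MonoidAlgebra.mapDomainNonUnitalAlgHom k k BWord.ofWord

/-- Operated polynomials in the two variables `x = 0` and `y = 1`. -/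
abbrev OPI := BWordAlg k (Fin 2)

section Eval

variable {k} {X : Type w} {C : Type v} [NonUnitalRing C] [Module k C]

/-- The value of an operated polynomial in the operated algebra `(C, P)`, when each variable `x`
is replaced by `r x`. -/
noncomputable def evalOPI (P : C →ₗ[k] C) (r : X → C) (φ : BWordAlg k X) : C :=
  φ.coeff.sum fun s c => c • s.eval P r

/-- The operated algebra `(C, P)` is a `φ`-algebra. -/
def IsPhiAlgebra (φ : OPI k) (P : C →ₗ[k] C) : Prop :=
  ∀ r : Fin 2 → C, evalOPI P r φ = 0

end Eval

variable {k Z}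

/-- The set of all `φ(s, t)` where `s` and `t` are words in the free operated semigroup. -/
def substSet (φ : OPI k) : Set (BWordAlg k Z) :=
  {f | ∃ r : Fin 2 → BWord Z, f = evalOPI (brOp k Z) (fun i => mono k (r i)) φ}

/-- The operated ideal generated by all `φ(s, t)` and by the ideal `I` of relations. -/
noncomputable def phiIdeal (φ : OPI k) (I : AlgIdeal k (WordAlg k Z)) :
    AlgIdeal k (BWordAlg k Z) :=
  AlgIdeal.operatedSpan (brOp k Z)
    (substSet φ ∪ incl k Z '' (I.toSubmodule : Set (WordAlg k Z)))

/-- The free nonunital `φ`-algebra over the algebra `A = k𝒮(Z) / I`. -/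
abbrev FreePhiAlg (φ : OPI k) (I : AlgIdeal k (WordAlg k Z)) := (phiIdeal φ I).Quot

/-- The operator of `FreePhiAlg φ I`. -/
noncomputable def freeOp (φ : OPI k) (I : AlgIdeal k (WordAlg k Z)) :
    FreePhiAlg φ I →ₗ[k] FreePhiAlg φ I :=
  (phiIdeal φ I).quotOperator (brOp k Z) fun _ hx => AlgIdeal.operatedSpan_stable _ _ hx

/-- The canonical homomorphism from `A = k𝒮(Z) / I` to `FreePhiAlg φ I`. -/
noncomputable def freeHom (φ : OPI k) (I : AlgIdeal k (WordAlg k Z)) :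
    I.Quot →ₙₐ[k] FreePhiAlg φ I :=
  I.quotMap (phiIdeal φ I) (incl k Z) fun x hx =>
    AlgIdeal.subset_operatedSpan _ _ (Or.inr ⟨x, hx, rfl⟩)

/-- The image of a word in `FreePhiAlg φ I`. -/
noncomputable def wordClass (φ : OPI k) (I : AlgIdeal k (WordAlg k Z)) (s : BWord Z) :
    FreePhiAlg φ I := (phiIdeal φ I).toQuot (mono k s)

end Operated

/-- The universal property: the operated algebra `(F, P)` with the algebra homomorphism
`j : A → F` is the free nonunital `φ`-algebra over the nonunital algebra `A`. -/
def IsFreePhiAlgebra {k : Type u} [Field k] (φ : OPI k)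
    {A F : Type v} [NonUnitalRing A] [Module k A] [NonUnitalRing F] [Module k F]
    (P : F →ₗ[k] F) (j : A →ₙₐ[k] F) : Prop :=
  IsPhiAlgebra φ P ∧
  ∀ (C : Type w) [NonUnitalRing C] [Module k C] [IsScalarTower k C C] [SMulCommClass k C C]
    (Q : C →ₗ[k] C), IsPhiAlgebra φ Q → ∀ f : A →ₙₐ[k] C,
    ∃! g : F →ₙₐ[k] C, (∀ a, g (P a) = Q (g a)) ∧ ∀ a, g (j a) = f a

/-! ### The operated polynomial identities -/

section Identities

variable {k : Type u} [Field k]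

/-- The variable `x`. -/
noncomputable def vx : OPI k := mono k (BWord.var 0)

/-- The variable `y`. -/
noncomputable def vy : OPI k := mono k (BWord.var 1)

/-- `⌊x⌋⌊y⌋ - lam (x⌊y⌋ + ⌊x⌋y) + mu ⌊xy⌋ + nu xy`. -/
noncomputable def opiN1a (lam mu nu : k) : OPI k :=
  brOp k (Fin 2) vx * brOp k (Fin 2) vy
    - lam • (vx * brOp k (Fin 2) vy + brOp k (Fin 2) vx * vy)
    + mu • brOp k (Fin 2) (vx * vy) + nu • (vx * vy)

/-- `⌊x⌋⌊y⌋ - lam (x⌊y⌋ + ⌊x⌋y) + mu ⌊yx⌋ + lam² xy - lam mu yx`. -/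
noncomputable def opiN2a (lam mu : k) : OPI k :=
  brOp k (Fin 2) vx * brOp k (Fin 2) vy
    - lam • (vx * brOp k (Fin 2) vy + brOp k (Fin 2) vx * vy)
    + mu • brOp k (Fin 2) (vy * vx) + lam ^ 2 • (vx * vy) - (lam * mu) • (vy * vx)

/-- `x⌊y⌋ - ⌊xy⌋ + ⌊x⌋y - lam xy`. -/
noncomputable def opiN1b (lam : k) : OPI k :=
  vx * brOp k (Fin 2) vy - brOp k (Fin 2) (vx * vy) + brOp k (Fin 2) vx * vy - lam • (vx * vy)

/-- `x⌊y⌋ - ⌊xy⌋`. -/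
noncomputable def opiN3 : OPI k := vx * brOp k (Fin 2) vy - brOp k (Fin 2) (vx * vy)

/-- `⌊x⌋y - ⌊xy⌋`. -/
noncomputable def opiN4 : OPI k := brOp k (Fin 2) vx * vy - brOp k (Fin 2) (vx * vy)

/-- The identities of the first group. -/
def IsPhi1 (φ : OPI k) : Prop :=
  (∃ lam mu nu : k, lam ^ 2 = lam * mu + nu ∧ φ = opiN1a lam mu nu) ∨
  (∃ lam mu : k, φ = opiN2a lam mu)

/-- The identities of the second group. -/
def IsPhi2 (φ : OPI k) : Prop := (∃ lam : k, φ = opiN1b lam) ∨ φ = opiN3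

/-- The identity of the third group. -/
def IsPhi3 (φ : OPI k) : Prop := φ = opiN4

end Identities

/-! ### Gröbner–Shirshov bases in the free nonunital algebra -/

/-- The word `a s b`, where `a` and `b` may be empty. -/
def ctx {S : Type u} [Mul S] (a b : WithOne S) (s : S) : S :=
  let t : S := WithOne.recOneCoe (motive := fun _ => S) s (fun x => x * s) a
  WithOne.recOneCoe (motive := fun _ => S) t (fun y => t * y) b

theorem coe_ctx {S : Type u} [Semigroup S] (a b : WithOne S) (s : S) :
    WithOne.coe (ctx a b s) = a * WithOne.coe s * b := by
  induction a using WithOne.recOneCoe <;> induction b using WithOne.recOneCoe <;>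
    simp [ctx]

section GS

variable {k : Type u} [Field k] {Z : Type v} [LinearOrder Z]

/-- The (strict) degree lexicographical order on the free semigroup. -/
def DlexLT (s t : FreeSemigroup Z) : Prop :=
  List.Shortlex (· < ·) (s.head :: s.tail) (t.head :: t.tail)

/-- `t` is the leading monomial of `f`. (The polynomial `0` has no leading monomial.) -/
def IsLeading (f : WordAlg k Z) (t : FreeSemigroup Z) : Prop :=
  t ∈ f.coeff.support ∧ ∀ s ∈ f.coeff.support, s ≠ t → DlexLT s t

/-- The polynomial `a f b`, where the words `a` and `b` may be empty. -/
noncomputable def polyCtx (a b : WithOne (FreeSemigroup Z)) (f : WordAlg k Z) : WordAlg k Z :=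
  MonoidAlgebra.mapDomainLinearMap k k (ctx a b) f

/-- `f` is trivial modulo `(G, t)`: it is a linear combination of polynomials `a g b` with
`g ∈ G` whose leading monomial is smaller than `t`. -/
def TrivialMod (G : Set (WordAlg k Z)) (t : FreeSemigroup Z) (f : WordAlg k Z) : Prop :=
  f ∈ Submodule.span k {h : WordAlg k Z | ∃ g ∈ G, ∃ lg, IsLeading g lg ∧
    ∃ a b, DlexLT (ctx a b lg) t ∧ h = polyCtx a b g}

/-- `G` is a Gröbner–Shirshov basis of the ideal `I`: it generates `I`, and all intersection and
inclusion compositions of its (nonzero, monicized) elements are trivial. -/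
def IsGSBasis (G : Set (WordAlg k Z)) (I : AlgIdeal k (WordAlg k Z)) : Prop :=
  AlgIdeal.span G = I ∧
  ∀ f ∈ G, ∀ g ∈ G, ∀ lf lg, IsLeading f lf → IsLeading g lg →
    (∀ t a b : FreeSemigroup Z, t = lf * a → t = b * lg →
      max lf.length lg.length < t.length → t.length < lf.length + lg.length →
      TrivialMod G t ((f.coeff lf)⁻¹ • (f * MonoidAlgebra.single a 1)
        - (g.coeff lg)⁻¹ • (MonoidAlgebra.single b 1 * g))) ∧
    (∀ a b : WithOne (FreeSemigroup Z), lf = ctx a b lg →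
      TrivialMod G lf ((f.coeff lf)⁻¹ • f - (g.coeff lg)⁻¹ • polyCtx a b g))

/-- The words, possibly empty, which have no leading monomial of an element of `G` as a
subword. -/
def IrrM (G : Set (WordAlg k Z)) : Set (WithOne (FreeSemigroup Z)) :=
  {t | ¬ ∃ g ∈ G, ∃ lg, IsLeading g lg ∧
    ∃ a b : WithOne (FreeSemigroup Z), t = a * WithOne.coe lg * b}

/-- The nonempty words which have no leading monomial of an element of `G` as a subword. -/
def IrrS (G : Set (WordAlg k Z)) : Set (FreeSemigroup Z) :=
  {t | ¬ ∃ g ∈ G, ∃ lg, IsLeading g lg ∧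
    ∃ a b : WithOne (FreeSemigroup Z), WithOne.coe t = a * WithOne.coe lg * b}

/-! ### The sets of words -/

/-- The words `u₀⌊v₁⌋u₁⋯⌊vᵣ⌋uᵣ` with `r ≥ 1`, where `u₀, uᵣ` are irreducible and possibly empty,
`u₁, …, uᵣ₋₁` are irreducible and nonempty, and all `vⱼ` belong to `V`. -/
def alternatingWords (G : Set (WordAlg k Z)) (V : Set (BWord Z)) : Set (BWord Z) :=
  {t | ∃ r : ℕ, 1 ≤ r ∧ ∃ (a : Fin (r + 1) → WithOne (FreeSemigroup Z)) (b : Fin r → BWord Z),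
    a 0 ∈ IrrM G ∧ a (Fin.last r) ∈ IrrM G ∧
    (∀ i, i ≠ 0 → i ≠ Fin.last r → ∃ s ∈ IrrS G, a i = WithOne.coe s) ∧
    (∀ j, b j ∈ V) ∧
    WithOne.coe t = BWord.ofWordM (a 0) *
      (List.ofFn fun j : Fin r =>
        WithOne.coe (b j).br * BWord.ofWordM (a j.succ)).prod}

/-- The sets `B₀ = Irr(G)` and `Bₙ₊₁ = B₀ ∪ {u₀⌊v₁⌋u₁⋯⌊vᵣ⌋uᵣ | vⱼ ∈ Bₙ}`. -/
def basisStep (G : Set (WordAlg k Z)) : ℕ → Set (BWord Z)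
  | 0 => BWord.ofWord '' IrrS G
  | n + 1 => BWord.ofWord '' IrrS G ∪ alternatingWords G (basisStep G n)

/-- The set `B = ⋃ₙ Bₙ`. -/
def basis1 (G : Set (WordAlg k Z)) : Set (BWord Z) := ⋃ n, basisStep G n

/-- `leftNest (u₁, k₁) [(u₂, k₂), …, (uᵣ, kᵣ)]` is the word
`⌊⌊⋯⌊⌊uᵣ⌋^(kᵣ) uᵣ₋₁⌋^(kᵣ₋₁) ⋯ u₂⌋^(k₂) u₁⌋^(k₁)`. -/
def leftNest (p : FreeSemigroup Z × ℕ) : List (FreeSemigroup Z × ℕ) → BWord Z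
  | [] => BWord.br^[p.2] (BWord.ofWord p.1)
  | q :: l => BWord.br^[p.2] (leftNest q l * BWord.ofWord p.1)

/-- `rightNest (u₁, k₁) [(u₂, k₂), …, (uᵣ, kᵣ)]` is the word
`⌊u₁ ⌊u₂ ⋯ ⌊uᵣ₋₁ ⌊uᵣ⌋^(kᵣ)⌋^(kᵣ₋₁) ⋯⌋^(k₂)⌋^(k₁)`. -/
def rightNest (p : FreeSemigroup Z × ℕ) : List (FreeSemigroup Z × ℕ) → BWord Z
  | [] => BWord.br^[p.2] (BWord.ofWord p.1)
  | q :: l => BWord.br^[p.2] (BWord.ofWord p.1 * rightNest q l)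

/-- `Irr(G)` together with all left-nested words `⌊⋯⌊uᵣ⌋^(kᵣ) uᵣ₋₁ ⋯ u₁⌋^(k₁) u₀`. -/
def basis2 (G : Set (WordAlg k Z)) : Set (BWord Z) :=
  BWord.ofWord '' IrrS G ∪
  {t | ∃ a ∈ IrrM G, ∃ (p : FreeSemigroup Z × ℕ) (l : List (FreeSemigroup Z × ℕ)),
    (∀ q ∈ p :: l, q.1 ∈ IrrS G ∧ 1 ≤ q.2) ∧
    WithOne.coe t = WithOne.coe (leftNest p l) * BWord.ofWordM a}

/-- `Irr(G)` together with all right-nested words `u₀ ⌊u₁ ⋯ uᵣ₋₁ ⌊uᵣ⌋^(kᵣ) ⋯⌋^(k₁)`. -/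
def basis3 (G : Set (WordAlg k Z)) : Set (BWord Z) :=
  BWord.ofWord '' IrrS G ∪
  {t | ∃ a ∈ IrrM G, ∃ (p : FreeSemigroup Z × ℕ) (l : List (FreeSemigroup Z × ℕ)),
    (∀ q ∈ p :: l, q.1 ∈ IrrS G ∧ 1 ≤ q.2) ∧
    WithOne.coe t = BWord.ofWordM a * WithOne.coe (rightNest p l)}

end GS

/-- The set `B` of words is a linear basis of the free `φ`-algebra: the family of the classes of
the words in `B` is linearly independent and spans. -/
def IsLinearBasis {k : Type u} [Field k] {Z : Type v} (φ : OPI k)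
    (I : AlgIdeal k (WordAlg k Z)) (B : Set (BWord Z)) : Prop :=
  LinearIndependent k (fun b : B => wordClass φ I b) ∧
  Submodule.span k (Set.range fun b : B => wordClass φ I b) = ⊤

end OpAlg

open OpAlg

namespace OpAlg

/-! ### Evaluation homomorphisms and the universal property -/

namespace BWord

variable {Z : Type*}

/-! Write `A` for `I.Quot`. The Gröbner–Shirshov basis enters only through the composition-diamond
lemma for `A`: the irreducible words form a basis of `A` (`irrBasis`). No compositions of operated
polynomials are computed. Instead, each linear basis is obtained by showing that the listed words
span, and that a concrete `φ`-algebra separates them.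

The universal property comes from evaluating words. Since `φ` is bilinear, imposing `φ(s, t) = 0` on
words imposes it on all elements (`isPhiAlgebra_freeOp`), and evaluation in a `φ`-algebra over `A`
factors through the quotient (`exists_freeHom_lift`). The latter also transports linear independence
from a model back to the free algebra.

All models act on linear combinations of lists. An element of an algebra with a chosen basis acts on
a list by multiplying into the first letter if that letter belongs to the basis, and by prepending
otherwise; associativity makes this an action (`actEnd_mul`). Applied to the empty list, a word in
normal form yields a single list from which the word can be read off, so distinct words have
independent images (`linearIndependent_of_decode`).

In (b) and (c), which are mirror images and share proofs through `tw`, the identity moves a bracket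
outwards past a factor, so the nested words span (`span_nestWords`). The model is the endomorphism
algebra of lists, or its opposite, and the operator is multiplication by the endomorphism
`bracketOp`, or a commutator with it plus a scalar (`linearIndependent_nestWords`).

In (a), the shifted operator `Q = P - lam` satisfies `Q(x)Q(y) = c Q(xy)`, or the same with `yx`,
where `c = -mu`. Adjacent brackets therefore merge with the loss of one bracket, and the alternating
words evaluated with `Q` span (`mul_mem_altSpan_of_le`). For independence, models are built by
recursion on the depth. If `(C, Q)` separates the words of `V`, then `C` with the product scaled by
`c` (and possibly reversed) acts on lists in which basis vectors of `C` serve as bracket letters,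
and the new operator sends an element of `C` to its action (`exists_model_succ`). Returning from `Q`
to `P` changes a word only by words with fewer brackets, a triangular change that preserves bases.
-/

theorem var_mul (z : Z) (t : BWord Z) : var z * t = varCons z t := rfl
theorem br_mul (s t : BWord Z) : br s * t = brCons s t := rfl
theorem varCons_mul (z : Z) (s t : BWord Z) : varCons z s * t = varCons z (s * t) := rfl
theorem brCons_mul (s s' t : BWord Z) : brCons s s' * t = brCons s (s' * t) := rfl

theorem eval_mul {C : Type*} [Semigroup C] (P : C → C) (r : Z → C) (s t : BWord Z) :
    eval P r (s * t) = eval P r s * eval P r t := by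
  induction s with
  | var z => rfl
  | br s _ => rfl
  | varCons z s ih => rw [varCons_mul, eval, ih, eval, mul_assoc]
  | brCons s s' _ ih => rw [brCons_mul, eval, ih, eval, mul_assoc]

/-- `BWord.eval` as a homomorphism of semigroups. -/
def evalMulHom {C : Type*} [Semigroup C] (P : C → C) (r : Z → C) : BWord Z →ₙ* C where
  toFun := eval P r
  map_mul' := eval_mul P r

theorem map_eval {C D : Type*} [Mul C] [Mul D] (P : C → C) (Q : D → D) (r : Z → C)
    (g : C → D) (hg : ∀ x y, g (x * y) = g x * g y) (hP : ∀ x, g (P x) = Q (g x))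
    (s : BWord Z) : g (eval P r s) = eval Q (fun z => g (r z)) s := by
  induction s with
  | var z => rfl
  | br s ih => rw [eval, hP, ih, eval]
  | varCons z s ih => rw [eval, hg, ih, eval]
  | brCons s s' ih ih' => rw [eval, hg, hP, ih, ih', eval]

theorem eval_ofWord {C : Type*} [Semigroup C] (P : C → C) (r : Z → C) (u : FreeSemigroup Z) :
    eval P r (ofWord u) = FreeSemigroup.lift r u :=
  DFunLike.congr_fun (FreeSemigroup.hom_ext (f := (evalMulHom P r).comp ofWord)
    (g := FreeSemigroup.lift r) rfl) u

end BWord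

section EvalHom

variable {k : Type*} [Field k] {X : Type*} {C : Type*} [NonUnitalRing C] [Module k C]
  [IsScalarTower k C C] [SMulCommClass k C C]

/-- Evaluation of operated polynomials as a homomorphism of algebras. -/
noncomputable def evalHom (P : C →ₗ[k] C) (r : X → C) : BWordAlg k X →ₙₐ[k] C :=
  MonoidAlgebra.liftMagma k (BWord.evalMulHom P r)

theorem evalHom_eq (P : C →ₗ[k] C) (r : X → C) (φ : BWordAlg k X) :
    evalHom P r φ = evalOPI P r φ := rfl

theorem evalHom_mono (P : C →ₗ[k] C) (r : X → C) (s : BWord X) :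
    evalHom P r (mono k s) = s.eval P r := by
  simp [evalHom_eq, evalOPI, mono]

theorem brOp_mono (s : BWord X) : brOp k X (mono k s) = mono k s.br := by
  simp [brOp, mono]

theorem mono_mul (s t : BWord X) : mono k s * mono k t = mono k (s * t) := by
  simp [mono]

theorem span_mono : Submodule.span k (Set.range (mono k : BWord X → BWordAlg k X)) = ⊤ := by
  rw [eq_top_iff]
  rintro f -
  induction f using MonoidAlgebra.induction_linear with
  | zero => exact zero_mem _
  | add f g hf hg => exact add_mem hf hg
  | single s c =>
    have : MonoidAlgebra.single s c = c • mono k s := by simp [mono]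
    rw [this]
    exact Submodule.smul_mem _ _ (Submodule.subset_span ⟨s, rfl⟩)

theorem linearMap_ext_mono {M : Type*} [AddCommGroup M] [Module k M] {f g : BWordAlg k X →ₗ[k] M}
    (h : ∀ s, f (mono k s) = g (mono k s)) : f = g :=
  LinearMap.ext_on span_mono (by rintro _ ⟨s, rfl⟩; exact h s)

theorem evalHom_brOp (P : C →ₗ[k] C) (r : X → C) (φ : BWordAlg k X) :
    evalHom P r (brOp k X φ) = P (evalHom P r φ) := by
  have h : ((evalHom P r : BWordAlg k X →ₗ[k] C) ∘ₗ brOp k X)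
      = P ∘ₗ (evalHom P r : BWordAlg k X →ₗ[k] C) := by
    refine linearMap_ext_mono fun s => ?_
    change evalHom P r (brOp k X (mono k s)) = P (evalHom P r (mono k s))
    rw [brOp_mono, evalHom_mono, evalHom_mono, BWord.eval]
  exact LinearMap.congr_fun h φ

/-- A homomorphism of operated algebras commutes with the evaluation of operated polynomials. -/
theorem map_evalHom {D : Type*} [NonUnitalRing D] [Module k D] [IsScalarTower k D D]
    [SMulCommClass k D D] (P : C →ₗ[k] C) (Q : D →ₗ[k] D) (g : C →ₙₐ[k] D)
    (hg : ∀ x, g (P x) = Q (g x)) (r : X → C) (φ : BWordAlg k X) :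
    g (evalHom P r φ) = evalHom Q (fun x => g (r x)) φ := by
  have h : ((g : C →ₗ[k] D) ∘ₗ (evalHom P r : BWordAlg k X →ₗ[k] C))
      = (evalHom Q (fun x => g (r x)) : BWordAlg k X →ₗ[k] D) := by
    refine linearMap_ext_mono fun s => ?_
    change g (evalHom P r (mono k s)) = evalHom Q (fun x => g (r x)) (mono k s)
    rw [evalHom_mono, evalHom_mono]
    exact BWord.map_eval P Q r g (map_mul g) hg s
  exact LinearMap.congr_fun h φ

end EvalHom

section Universal

variable {k : Type u} [Field k] {Z : Type v}

/-- The image of a letter in the algebra `k𝒮(Z) / I`. -/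
noncomputable def letter (I : AlgIdeal k (WordAlg k Z)) (u : FreeSemigroup Z) : I.Quot :=
  I.toQuot (MonoidAlgebra.single u 1)

theorem letter_mul (I : AlgIdeal k (WordAlg k Z)) (s t : FreeSemigroup Z) :
    letter I (s * t) = letter I s * letter I t := by
  rw [letter, letter, letter, ← AlgIdeal.toQuot_mul, MonoidAlgebra.single_mul_single, one_mul]

theorem lift_letter {C : Type*} [Semigroup C] (I : AlgIdeal k (WordAlg k Z)) (f : I.Quot → C)
    (hf : ∀ x y, f (x * y) = f x * f y) (u : FreeSemigroup Z) :
    FreeSemigroup.lift (fun z => f (letter I (FreeSemigroup.of z))) u = f (letter I u) :=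
  DFunLike.congr_fun (FreeSemigroup.hom_ext
    (f := FreeSemigroup.lift (fun z => f (letter I (FreeSemigroup.of z))))
    (g := { toFun := fun u => f (letter I u), map_mul' := fun s t => by rw [letter_mul, hf] })
    rfl) u

theorem eval_ofWord_letter {C : Type*} [Semigroup C] (I : AlgIdeal k (WordAlg k Z)) (f : I.Quot → C)
    (hf : ∀ x y, f (x * y) = f x * f y) (P : C → C) (u : FreeSemigroup Z) :
    (BWord.ofWord u).eval P (fun z => f (letter I (FreeSemigroup.of z))) = f (letter I u) := by
  rw [BWord.eval_ofWord, lift_letter I f hf]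

variable (φ : OPI k) (I : AlgIdeal k (WordAlg k Z))

theorem freeOp_toQuot (x : BWordAlg k Z) :
    freeOp φ I ((phiIdeal φ I).toQuot x) = (phiIdeal φ I).toQuot (brOp k Z x) := rfl

theorem freeHom_toQuot (x : WordAlg k Z) :
    freeHom φ I (I.toQuot x) = (phiIdeal φ I).toQuot (incl k Z x) := rfl

theorem wordClass_mul (s t : BWord Z) :
    wordClass φ I (s * t) = wordClass φ I s * wordClass φ I t := by
  rw [wordClass, ← mono_mul, AlgIdeal.toQuot_mul]; rfl

theorem wordClass_br (s : BWord Z) : wordClass φ I s.br = freeOp φ I (wordClass φ I s) := by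
  rw [wordClass, ← brOp_mono]; rfl

theorem incl_single (u : FreeSemigroup Z) :
    incl k Z (MonoidAlgebra.single u 1) = mono k (BWord.ofWord u) := by
  simp [incl, mono]

theorem freeHom_letter (u : FreeSemigroup Z) :
    freeHom φ I (letter I u) = wordClass φ I (BWord.ofWord u) := by
  rw [letter, freeHom_toQuot, incl_single]; rfl

/-- With this form `BWord.map_eval` applies to classes of words: a homomorphism of operated algebras
is determined on them by its values on the image of `A`. -/
theorem wordClass_eq_eval (s : BWord Z) : wordClass φ I s =
    s.eval (freeOp φ I) fun z => freeHom φ I (letter I (FreeSemigroup.of z)) := by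
  have h : ∀ z : Z, freeHom φ I (letter I (FreeSemigroup.of z)) = wordClass φ I (BWord.var z) :=
    fun z => freeHom_letter φ I _
  induction s with
  | var z => exact (h z).symm
  | br s ih => rw [wordClass_br, ih]; rfl
  | varCons z s ih => rw [← BWord.var_mul, wordClass_mul, ih, ← h]; rfl
  | brCons s s' ih ih' =>
    rw [← BWord.br_mul, wordClass_mul, wordClass_br, ih, ih']; rfl

theorem span_wordClass : Submodule.span k (Set.range (wordClass φ I)) = ⊤ := by
  have : Set.range (wordClass φ I) = (phiIdeal φ I).toQuot '' Set.range (mono k) := by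
    rw [← Set.range_comp]; rfl
  rw [this, ← Submodule.map_span, span_mono, Submodule.map_top, LinearMap.range_eq_top]
  exact AlgIdeal.toQuot_surjective _

/-- `φ` is linear in each of its two variables, on each operated algebra. -/
def IsBilinearOPI (φ : OPI k) : Prop :=
  ∀ {C : Type (max u v)} [NonUnitalRing C] [Module k C] [IsScalarTower k C C] [SMulCommClass k C C]
    (P : C →ₗ[k] C), ∃ β : C →ₗ[k] C →ₗ[k] C, ∀ r, evalHom P r φ = β (r 0) (r 1)

variable {φ}

/-- The ideal contains `φ(s, t)` only for words `s` and `t`. Classes of words span, so the bilinear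
map that represents `φ` vanishes as soon as it vanishes on pairs of words. -/
theorem isPhiAlgebra_freeOp (hφ : IsBilinearOPI.{u, v} φ) : IsPhiAlgebra φ (freeOp φ I) := by
  obtain ⟨β, hβ⟩ := hφ (freeOp φ I)
  suffices h : β = 0 by
    intro r
    rw [← evalHom_eq, hβ, h]; rfl
  refine LinearMap.ext_on (span_wordClass φ I) ?_
  rintro _ ⟨s, rfl⟩
  refine LinearMap.ext_on (span_wordClass φ I) ?_
  rintro _ ⟨t, rfl⟩
  let q : BWordAlg k Z →ₙₐ[k] FreePhiAlg φ I :=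
    { (phiIdeal φ I).toQuot with
      map_zero' := map_zero (phiIdeal φ I).toQuot
      map_mul' := AlgIdeal.toQuot_mul _ }
  have h := map_evalHom (brOp k Z) (freeOp φ I) q (fun _ => rfl)
    (fun i => mono k (![s, t] i)) φ
  rw [hβ] at h
  refine h.symm.trans ?_
  have h0 : evalHom (brOp k Z) (fun i => mono k (![s, t] i)) φ ∈ (phiIdeal φ I).toSubmodule :=
    AlgIdeal.subset_operatedSpan _ _ (Or.inl ⟨![s, t], rfl⟩)
  exact (Submodule.Quotient.mk_eq_zero _).2 h0

variable (φ)

/-- The kernel of evaluation is an operated ideal that contains every `φ(s, t)` and the image of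
`I`, hence the smallest such ideal. Bilinearity of `φ` is not needed here. -/
theorem exists_freeHom_lift {C : Type w} [NonUnitalRing C] [Module k C] [IsScalarTower k C C]
    [SMulCommClass k C C] (Q : C →ₗ[k] C) (hQ : IsPhiAlgebra φ Q) (f : I.Quot →ₙₐ[k] C) :
    ∃ g : FreePhiAlg φ I →ₙₐ[k] C, (∀ a, g (freeOp φ I a) = Q (g a)) ∧
      ∀ a, g (freeHom φ I a) = f a := by
  set e := evalHom Q (fun z : Z => f (letter I (FreeSemigroup.of z))) with he
  have hincl : ∀ x : WordAlg k Z, e (incl k Z x) = f (I.toQuot x) := by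
    intro x
    induction x using MonoidAlgebra.induction_linear with
    | zero => rw [map_zero, map_zero, map_zero, map_zero]
    | add x y hx hy => rw [map_add, map_add, hx, hy, map_add, map_add]
    | single s c =>
      have : (MonoidAlgebra.single s c : WordAlg k Z) = c • MonoidAlgebra.single s 1 := by simp
      rw [this, map_smul, map_smul, map_smul, map_smul, incl_single, he, evalHom_mono,
        eval_ofWord_letter I f (map_mul f)]; rfl
  have hker : (phiIdeal φ I).toSubmodule ≤ LinearMap.ker (e : BWordAlg k Z →ₗ[k] C) := by
    refine sInf_le ⟨⟨?_, ?_⟩, ?_, ?_⟩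
    · intro r x hx
      have hx : e x = 0 := hx
      change e (r * x) = 0
      rw [map_mul, hx, mul_zero]
    · intro r x hx
      have hx : e x = 0 := hx
      change e (x * r) = 0
      rw [map_mul, hx, zero_mul]
    · intro x hx
      have hx : e x = 0 := hx
      change e (brOp k Z x) = 0
      rw [he, evalHom_brOp, ← he, hx, map_zero]
    · rintro x (⟨r, rfl⟩ | ⟨y, hy, rfl⟩)
      · change e (evalOPI _ _ _) = 0
        rw [← evalHom_eq, map_evalHom _ Q e (evalHom_brOp _ _), evalHom_eq]
        exact hQ _
      · change e (incl k Z y) = 0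
        rw [hincl, show I.toQuot y = 0 from (Submodule.Quotient.mk_eq_zero _).2 hy, map_zero]
  let g : FreePhiAlg φ I →ₗ[k] C := (phiIdeal φ I).toSubmodule.liftQ _ hker
  have hg : ∀ x, g ((phiIdeal φ I).toQuot x) = e x := fun x => rfl
  refine ⟨{ g with
    map_zero' := map_zero g
    map_mul' := ?_ }, ?_, ?_⟩
  · intro a b
    obtain ⟨a, rfl⟩ := AlgIdeal.toQuot_surjective _ a
    obtain ⟨b, rfl⟩ := AlgIdeal.toQuot_surjective _ b
    change g _ = g _ * g _
    rw [← AlgIdeal.toQuot_mul, hg, hg, hg, map_mul]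
  · intro a
    obtain ⟨a, rfl⟩ := AlgIdeal.toQuot_surjective _ a
    change g (freeOp φ I ((phiIdeal φ I).toQuot a)) = Q (g ((phiIdeal φ I).toQuot a))
    rw [freeOp_toQuot, hg, hg]
    exact evalHom_brOp _ _ _
  · intro a
    obtain ⟨a, rfl⟩ := AlgIdeal.toQuot_surjective _ a
    change g (freeHom φ I (I.toQuot a)) = _
    rw [freeHom_toQuot, hg, hincl]

variable {φ}

/-- Existence is `exists_freeHom_lift`. Uniqueness holds because both homomorphisms send the class
of a word to the same evaluation, and these classes span. -/
theorem isFreePhiAlgebra_of_isBilinear (hφ : IsBilinearOPI.{u, v} φ) :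
    IsFreePhiAlgebra.{u, max u v, w} φ (freeOp φ I) (freeHom φ I) := by
  refine ⟨isPhiAlgebra_freeOp I hφ, ?_⟩
  intro C _ _ _ _ Q hQ f
  obtain ⟨g, hg1, hg2⟩ := exists_freeHom_lift φ I Q hQ f
  refine ⟨g, ⟨hg1, hg2⟩, ?_⟩
  rintro g' ⟨h1, h2⟩
  have key : ∀ (g : FreePhiAlg φ I →ₙₐ[k] C), (∀ a, g (freeOp φ I a) = Q (g a)) →
      (∀ a, g (freeHom φ I a) = f a) → ∀ s, g (wordClass φ I s) =
        s.eval Q fun z => f (letter I (FreeSemigroup.of z)) := by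
    intro g hg1 hg2 s
    rw [wordClass_eq_eval, BWord.map_eval _ Q _ g (map_mul g) hg1]
    simp only [hg2]
  have : (g' : FreePhiAlg φ I →ₗ[k] C) = (g : FreePhiAlg φ I →ₗ[k] C) := by
    refine LinearMap.ext_on (span_wordClass φ I) ?_
    rintro _ ⟨s, rfl⟩
    exact (key g' h1 h2 s).trans (key g hg1 hg2 s).symm
  exact NonUnitalAlgHom.ext fun x => LinearMap.congr_fun this x

end Universal

/-! ### The five identities in an operated algebra, and their bilinearity. -/

section Formulas

variable {k : Type u} [Field k] {C : Type*} [NonUnitalRing C] [Module k C]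
  [IsScalarTower k C C] [SMulCommClass k C C] (P : C →ₗ[k] C) (r : Fin 2 → C)

theorem evalHom_vx : evalHom P r vx = r 0 := evalHom_mono P r _
theorem evalHom_vy : evalHom P r vy = r 1 := evalHom_mono P r _

theorem evalHom_opiN1a (lam mu nu : k) : evalHom P r (opiN1a lam mu nu) =
    P (r 0) * P (r 1) - lam • (r 0 * P (r 1) + P (r 0) * r 1) + mu • P (r 0 * r 1)
      + nu • (r 0 * r 1) := by
  simp only [opiN1a, map_add, map_sub, map_smul, map_mul, evalHom_brOp, evalHom_vx, evalHom_vy]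

theorem evalHom_opiN2a (lam mu : k) : evalHom P r (opiN2a lam mu) =
    P (r 0) * P (r 1) - lam • (r 0 * P (r 1) + P (r 0) * r 1) + mu • P (r 1 * r 0)
      + lam ^ 2 • (r 0 * r 1) - (lam * mu) • (r 1 * r 0) := by
  simp only [opiN2a, map_add, map_sub, map_smul, map_mul, evalHom_brOp, evalHom_vx, evalHom_vy]

theorem evalHom_opiN1b (lam : k) : evalHom P r (opiN1b lam) =
    r 0 * P (r 1) - P (r 0 * r 1) + P (r 0) * r 1 - lam • (r 0 * r 1) := by
  simp only [opiN1b, map_add, map_sub, map_smul, map_mul, evalHom_brOp, evalHom_vx, evalHom_vy]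

theorem evalHom_opiN3 : evalHom P r (opiN3 : OPI k) = r 0 * P (r 1) - P (r 0 * r 1) := by
  simp only [opiN3, map_sub, map_mul, evalHom_brOp, evalHom_vx, evalHom_vy]

theorem evalHom_opiN4 : evalHom P r (opiN4 : OPI k) = P (r 0) * r 1 - P (r 0 * r 1) := by
  simp only [opiN4, map_sub, map_mul, evalHom_brOp, evalHom_vx, evalHom_vy]

end Formulas

section Bilinear

variable {k : Type u} [Field k]

/-- A linear combination of the bilinear monomials `⌊x⌋⌊y⌋`, `x⌊y⌋`, `⌊x⌋y`, `⌊xy⌋`, `⌊yx⌋`, `xy`,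
`yx` as a bilinear map. -/
noncomputable def bilinearOp {C : Type*} [NonUnitalRing C] [Module k C]
    [IsScalarTower k C C] [SMulCommClass k C C] (P : C →ₗ[k] C) (c : Fin 7 → k) :
    C →ₗ[k] C →ₗ[k] C :=
  c 0 • (LinearMap.mul k C).compl₁₂ P P + c 1 • (LinearMap.mul k C).compl₂ P
    + c 2 • (LinearMap.mul k C ∘ₗ P) + c 3 • (LinearMap.mul k C).compr₂ P
    + c 4 • (LinearMap.mul k C).flip.compr₂ P + c 5 • LinearMap.mul k C
    + c 6 • (LinearMap.mul k C).flip

theorem bilinearOp_apply {C : Type*} [NonUnitalRing C] [Module k C]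
    [IsScalarTower k C C] [SMulCommClass k C C] (P : C →ₗ[k] C) (c : Fin 7 → k) (x y : C) :
    bilinearOp P c x y = c 0 • (P x * P y) + c 1 • (x * P y) + c 2 • (P x * y) + c 3 • P (x * y)
      + c 4 • P (y * x) + c 5 • (x * y) + c 6 • (y * x) := rfl

theorem isBilinearOPI_opiN1a (lam mu nu : k) : IsBilinearOPI.{u, v} (opiN1a lam mu nu) := by
  intro C _ _ _ _ P
  refine ⟨bilinearOp P ![1, -lam, -lam, mu, 0, nu, 0], fun r => ?_⟩
  rw [evalHom_opiN1a, bilinearOp_apply]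
  simp; module

theorem isBilinearOPI_opiN2a (lam mu : k) : IsBilinearOPI.{u, v} (opiN2a lam mu) := by
  intro C _ _ _ _ P
  refine ⟨bilinearOp P ![1, -lam, -lam, 0, mu, lam ^ 2, - (lam * mu)], fun r => ?_⟩
  rw [evalHom_opiN2a, bilinearOp_apply]
  simp; module

theorem isBilinearOPI_opiN1b (lam : k) : IsBilinearOPI.{u, v} (opiN1b lam) := by
  intro C _ _ _ _ P
  refine ⟨bilinearOp P ![0, 1, 1, -1, 0, -lam, 0], fun r => ?_⟩
  rw [evalHom_opiN1b, bilinearOp_apply]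
  simp; module

theorem isBilinearOPI_opiN3 : IsBilinearOPI.{u, v} (opiN3 : OPI k) := by
  intro C _ _ _ _ P
  refine ⟨bilinearOp P ![0, 1, 0, -1, 0, 0, 0], fun r => ?_⟩
  rw [evalHom_opiN3, bilinearOp_apply]
  simp; module

theorem isBilinearOPI_opiN4 : IsBilinearOPI.{u, v} (opiN4 : OPI k) := by
  intro C _ _ _ _ P
  refine ⟨bilinearOp P ![0, 0, 1, -1, 0, 0, 0], fun r => ?_⟩
  rw [evalHom_opiN4, bilinearOp_apply]
  simp; module

end Bilinear

/-! ### Irreducible words span -/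

section Leading

variable {k : Type u} [Field k] {Z : Type v}

/-- The list of letters of a possibly empty word. -/
def letters : WithOne (FreeSemigroup Z) → List Z :=
  WithOne.recOneCoe (motive := fun _ => List Z) [] fun u => u.head :: u.tail

@[simp] theorem letters_one : letters (1 : WithOne (FreeSemigroup Z)) = [] := rfl

@[simp] theorem letters_coe (u : FreeSemigroup Z) : letters (WithOne.coe u) = u.head :: u.tail :=
  rfl

@[simp] theorem letters_mul (a b : WithOne (FreeSemigroup Z)) :
    letters (a * b) = letters a ++ letters b := by
  induction a using WithOne.recOneCoe with
  | one => simp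
  | coe a =>
    induction b using WithOne.recOneCoe with
    | one => simp
    | coe b => rw [← WithOne.coe_mul, letters_coe, letters_coe, letters_coe]; simp

theorem letters_injective : Function.Injective (letters (Z := Z)) := by
  intro a b h
  induction a using WithOne.recOneCoe <;> induction b using WithOne.recOneCoe
  · rfl
  · simp at h
  · simp at h
  · simp only [letters_coe, List.cons.injEq] at h
    exact congrArg _ (FreeSemigroup.ext h.1 h.2)

theorem letters_surjective : Function.Surjective (letters (Z := Z)) := by
  rintro (_ | ⟨z, l⟩)
  · exact ⟨1, rfl⟩
  · exact ⟨WithOne.coe ⟨z, l⟩, rfl⟩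

/-- Two factorizations of a word have a common refinement. -/
theorem exists_of_mul_eq_mul {a b c d : WithOne (FreeSemigroup Z)} (h : a * b = c * d) :
    (∃ e, c = a * e ∧ b = e * d) ∨ (∃ e, a = c * e ∧ d = e * b) := by
  have h' := congrArg letters h
  rw [letters_mul, letters_mul, List.append_eq_append_iff] at h'
  rcases h' with ⟨l, h1, h2⟩ | ⟨l, h1, h2⟩
  · obtain ⟨e, rfl⟩ := letters_surjective l
    exact Or.inl ⟨e, letters_injective (by simpa using h1), letters_injective (by simpa using h2)⟩
  · obtain ⟨e, rfl⟩ := letters_surjective l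
    exact Or.inr ⟨e, letters_injective (by simpa using h1), letters_injective (by simpa using h2)⟩

theorem polyCtx_single (a b : WithOne (FreeSemigroup Z)) (s : FreeSemigroup Z) (c : k) :
    polyCtx a b (MonoidAlgebra.single s c) = MonoidAlgebra.single (ctx a b s) c := by
  simp [polyCtx]

/-- `polyCtx` as a linear map. -/
noncomputable def polyCtxHom (k : Type u) [Field k] (a b : WithOne (FreeSemigroup Z)) :
    WordAlg k Z →ₗ[k] WordAlg k Z :=
  MonoidAlgebra.mapDomainLinearMap k k (ctx a b)

theorem polyCtx_eq (a b : WithOne (FreeSemigroup Z)) (f : WordAlg k Z) :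
    polyCtx a b f = polyCtxHom k a b f := rfl

theorem single_eq_smul_single (s : FreeSemigroup Z) (c : k) :
    (MonoidAlgebra.single s c : WordAlg k Z) = c • MonoidAlgebra.single s 1 := by simp

theorem wordAlg_ext {M : Type*} [AddCommGroup M] [Module k M] {f g : WordAlg k Z →ₗ[k] M}
    (h : ∀ s, f (MonoidAlgebra.single s 1) = g (MonoidAlgebra.single s 1)) : f = g := by
  refine LinearMap.ext fun x => ?_
  induction x using MonoidAlgebra.induction_linear with
  | zero => rw [map_zero, map_zero]
  | add x y hx hy => rw [map_add, map_add, hx, hy]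
  | single s c =>
    have : (MonoidAlgebra.single s c : WordAlg k Z) = c • MonoidAlgebra.single s 1 := by simp
    rw [this, map_smul, map_smul, h]

theorem ctx_ctx (a b c d : WithOne (FreeSemigroup Z)) (s : FreeSemigroup Z) :
    ctx a b (ctx c d s) = ctx (a * c) (d * b) s := by
  apply WithOne.coe_injective
  simp only [coe_ctx, mul_assoc]

theorem polyCtxHom_comp (a b c d : WithOne (FreeSemigroup Z)) (f : WordAlg k Z) :
    polyCtxHom k a b (polyCtxHom k c d f) = polyCtxHom k (a * c) (d * b) f := by
  have : polyCtxHom k a b ∘ₗ polyCtxHom k c d = polyCtxHom k (a * c) (d * b) := by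
    refine wordAlg_ext fun s => ?_
    simp only [LinearMap.comp_apply, ← polyCtx_eq, polyCtx_single, ctx_ctx]
  exact LinearMap.congr_fun this f

theorem polyCtxHom_one_one (f : WordAlg k Z) : polyCtxHom k 1 1 f = f := by
  have : polyCtxHom k (1 : WithOne (FreeSemigroup Z)) 1 = LinearMap.id := by
    refine wordAlg_ext fun s => ?_
    rw [← polyCtx_eq, polyCtx_single]
    rfl
  exact LinearMap.congr_fun this f

theorem single_mul_eq_polyCtxHom (u : FreeSemigroup Z) (f : WordAlg k Z) :
    MonoidAlgebra.single u 1 * f = polyCtxHom k (WithOne.coe u) 1 f := by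
  have : LinearMap.mulLeft k (MonoidAlgebra.single u 1 : WordAlg k Z)
      = polyCtxHom k (WithOne.coe u) 1 := by
    refine wordAlg_ext fun s => ?_
    rw [← polyCtx_eq, polyCtx_single]
    simp [ctx]
  exact LinearMap.congr_fun this f

theorem mul_single_eq_polyCtxHom (u : FreeSemigroup Z) (f : WordAlg k Z) :
    f * MonoidAlgebra.single u 1 = polyCtxHom k 1 (WithOne.coe u) f := by
  have : LinearMap.mulRight k (MonoidAlgebra.single u 1 : WordAlg k Z)
      = polyCtxHom k 1 (WithOne.coe u) := by
    refine wordAlg_ext fun s => ?_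
    rw [← polyCtx_eq, polyCtx_single]
    simp [ctx]
  exact LinearMap.congr_fun this f

theorem polyCtxHom_mem_ideal (I : AlgIdeal k (WordAlg k Z)) (a b : WithOne (FreeSemigroup Z))
    {f : WordAlg k Z} (hf : f ∈ I.toSubmodule) : polyCtxHom k a b f ∈ I.toSubmodule := by
  have h1 : ∀ a, ∀ f ∈ I.toSubmodule, polyCtxHom k a 1 f ∈ I.toSubmodule := by
    intro a f hf
    induction a using WithOne.recOneCoe with
    | one => rwa [polyCtxHom_one_one]
    | coe a => rw [← single_mul_eq_polyCtxHom]; exact I.mul_mem_left _ hf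
  have h2 : ∀ b, ∀ f ∈ I.toSubmodule, polyCtxHom k 1 b f ∈ I.toSubmodule := by
    intro b f hf
    induction b using WithOne.recOneCoe with
    | one => rwa [polyCtxHom_one_one]
    | coe b => rw [← mul_single_eq_polyCtxHom]; exact I.mul_mem_right _ hf
  have := h1 a _ (h2 b f hf)
  rwa [polyCtxHom_comp, mul_one, mul_one] at this

theorem subset_span (G : Set (WordAlg k Z)) : G ⊆ (AlgIdeal.span (k := k) G).toSubmodule :=
  fun _ hx => (Submodule.mem_sInf).2 fun _ hI => hI.2 hx

variable [LinearOrder Z]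

/-- The degree lexicographical order on possibly empty words. -/
def wordLT (a b : WithOne (FreeSemigroup Z)) : Prop :=
  List.Shortlex (· < ·) (letters a) (letters b)

theorem dlexLT_iff {s t : FreeSemigroup Z} : DlexLT s t ↔ wordLT (WithOne.coe s) (WithOne.coe t) :=
  Iff.rfl

theorem wordLT_trans {a b c : WithOne (FreeSemigroup Z)} (h : wordLT a b) (h' : wordLT b c) :
    wordLT a c := by
  rw [wordLT, List.shortlex_def] at *
  rcases h with h | ⟨h1, h2⟩ <;> rcases h' with h' | ⟨h1', h2'⟩
  · left; lia
  · left; lia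
  · left; lia
  · exact Or.inr ⟨h1.trans h1', List.lex_trans (fun h h' => lt_trans h h') h2 h2'⟩

theorem wordLT_irrefl (a : WithOne (FreeSemigroup Z)) : ¬ wordLT a a :=
  fun h => (Std.Asymm.asymm (r := List.Shortlex ((· < ·) : Z → Z → Prop)) _ _ h) h

theorem wordLT_trichotomous (a b : WithOne (FreeSemigroup Z)) :
    wordLT a b ∨ a = b ∨ wordLT b a := by
  by_contra! h
  exact h.2.1 (letters_injective
    (Std.Trichotomous.trichotomous (r := List.Shortlex ((· < ·) : Z → Z → Prop)) _ _ h.1 h.2.2))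

theorem wordLT_wf [WellFoundedLT Z] : WellFounded (wordLT (Z := Z)) :=
  InvImage.wf letters (List.Shortlex.wf (wellFounded_lt (α := Z)))

/-- Equal lengths exclude the case of a proper prefix, where appending on the right could reverse
the lexicographical order. -/
theorem lex_append_right {l m : List Z} (h : List.Lex (· < ·) l m) (hl : l.length = m.length)
    (t : List Z) : List.Lex (· < ·) (l ++ t) (m ++ t) := by
  induction h with
  | nil => simp at hl
  | cons h ih => exact List.Lex.cons (ih (by simpa using hl))
  | rel h => exact List.Lex.rel h

theorem wordLT_mul {s t : WithOne (FreeSemigroup Z)} (h : wordLT s t)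
    (a b : WithOne (FreeSemigroup Z)) : wordLT (a * s * b) (a * t * b) := by
  rw [wordLT, letters_mul, letters_mul, letters_mul, letters_mul, List.append_assoc,
    List.append_assoc]
  refine List.Shortlex.append_left ?_ _
  rw [wordLT, List.shortlex_def] at h
  rw [List.shortlex_def]
  rcases h with h | ⟨h1, h2⟩
  · left; simp; lia
  · exact Or.inr ⟨by simp [h1], lex_append_right h2 h1 _⟩

theorem ctx_lt {s t : FreeSemigroup Z} (h : DlexLT s t) (a b : WithOne (FreeSemigroup Z)) :
    DlexLT (ctx a b s) (ctx a b t) := by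
  rw [dlexLT_iff, coe_ctx, coe_ctx]
  exact wordLT_mul (dlexLT_iff.1 h) a b

theorem dlexLT_wf [WellFoundedLT Z] : WellFounded (DlexLT (Z := Z)) :=
  InvImage.wf WithOne.coe wordLT_wf

theorem dlexLT_trans {a b c : FreeSemigroup Z} (h : DlexLT a b) (h' : DlexLT b c) : DlexLT a c :=
  dlexLT_iff.2 (wordLT_trans (dlexLT_iff.1 h) (dlexLT_iff.1 h'))

theorem dlexLT_irrefl (a : FreeSemigroup Z) : ¬ DlexLT a a := fun h =>
  wordLT_irrefl _ (dlexLT_iff.1 h)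

theorem dlexLT_trichotomous (a b : FreeSemigroup Z) : DlexLT a b ∨ a = b ∨ DlexLT b a := by
  simpa only [dlexLT_iff, WithOne.coe_inj] using wordLT_trichotomous (WithOne.coe a) (WithOne.coe b)

/-- The span of the words which are smaller than `t`. -/
noncomputable def lowerSpan (k : Type u) [Field k] (t : FreeSemigroup Z) : Submodule k (WordAlg k Z) :=
  Submodule.span k ((fun s => MonoidAlgebra.single s 1) '' {s | DlexLT s t})

theorem single_mem_lowerSpan {s t : FreeSemigroup Z} (h : DlexLT s t) :
    (MonoidAlgebra.single s 1 : WordAlg k Z) ∈ lowerSpan k t :=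
  Submodule.subset_span ⟨s, h, rfl⟩

theorem coeff_eq_zero_of_mem_lowerSpan {t : FreeSemigroup Z} {f : WordAlg k Z}
    (hf : f ∈ lowerSpan k t) {s : FreeSemigroup Z} (hs : ¬ DlexLT s t) : f.coeff s = 0 := by
  induction hf using Submodule.span_induction with
  | mem x hx =>
    obtain ⟨s', hs', rfl⟩ := hx
    have : s' ≠ s := by rintro rfl; exact hs hs'
    simp [this]
  | zero => rfl
  | add x y _ _ hx hy => simp [hx, hy]
  | smul c x _ hx => simp [hx]

theorem mem_lowerSpan_of_forall {t : FreeSemigroup Z} {f : WordAlg k Z}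
    (h : ∀ s ∈ f.coeff.support, DlexLT s t) : f ∈ lowerSpan k t := by
  rw [← MonoidAlgebra.sum_coeff_single f]
  refine Submodule.sum_mem _ fun s hs => ?_
  have : (MonoidAlgebra.single s (f.coeff s) : WordAlg k Z)
    = f.coeff s • MonoidAlgebra.single s 1 := by simp
  rw [this]
  exact Submodule.smul_mem _ _ (single_mem_lowerSpan (h s hs))

theorem IsLeading.coeff_ne_zero {f : WordAlg k Z} {t : FreeSemigroup Z} (h : IsLeading f t) :
    f.coeff t ≠ 0 := Finsupp.mem_support_iff.1 h.1

/-- A polynomial divided by its leading coefficient is its leading monomial up to smaller words. -/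
theorem IsLeading.monic_sub_mem {f : WordAlg k Z} {t : FreeSemigroup Z} (h : IsLeading f t) :
    (f.coeff t)⁻¹ • f - MonoidAlgebra.single t 1 ∈ lowerSpan k t := by
  refine mem_lowerSpan_of_forall fun s hs => ?_
  rw [Finsupp.mem_support_iff] at hs
  by_cases hst : s = t
  · subst hst
    exfalso; apply hs
    simp [h.coeff_ne_zero]
  · refine h.2 s ?_ hst
    rw [Finsupp.mem_support_iff]
    intro h0
    apply hs
    simp [h0, Ne.symm hst]

theorem polyCtxHom_mem_lowerSpan {t : FreeSemigroup Z} {f : WordAlg k Z} (hf : f ∈ lowerSpan k t)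
    (a b : WithOne (FreeSemigroup Z)) : polyCtxHom k a b f ∈ lowerSpan k (ctx a b t) := by
  have : lowerSpan k t ≤ (lowerSpan k (ctx a b t)).comap (polyCtxHom k a b) := by
    refine Submodule.span_le.2 ?_
    rintro _ ⟨s, hs, rfl⟩
    change polyCtx a b (MonoidAlgebra.single s 1) ∈ lowerSpan k (ctx a b t)
    rw [polyCtx_single]
    exact single_mem_lowerSpan (ctx_lt hs a b)
  exact this hf

/-- The span of the polynomials `a g b` with `g ∈ G` which satisfies a condition on its
leading monomial. -/
noncomputable def reducibleSpan (G : Set (WordAlg k Z)) (p : FreeSemigroup Z → Prop) : Submodule k (WordAlg k Z) :=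
  Submodule.span k {h | ∃ g ∈ G, ∃ lg, IsLeading g lg ∧
    ∃ a b, p (ctx a b lg) ∧ h = polyCtx a b g}

theorem reducibleSpan_mono (G : Set (WordAlg k Z)) {p q : FreeSemigroup Z → Prop}
    (h : ∀ s, p s → q s) : reducibleSpan G p ≤ reducibleSpan G q :=
  Submodule.span_mono fun _ ⟨g, hg, lg, hl, a, b, hp, e⟩ => ⟨g, hg, lg, hl, a, b, h _ hp, e⟩

theorem polyCtxHom_mem_reducibleSpan {G : Set (WordAlg k Z)} {p q : FreeSemigroup Z → Prop}
    (a b : WithOne (FreeSemigroup Z)) (hpq : ∀ s, p s → q (ctx a b s)) {f : WordAlg k Z}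
    (hf : f ∈ reducibleSpan G p) : polyCtxHom k a b f ∈ reducibleSpan G q := by
  have : reducibleSpan G p ≤ (reducibleSpan G q).comap (polyCtxHom k a b) := by
    refine Submodule.span_le.2 ?_
    rintro _ ⟨g, hg, lg, hl, c, d, hp, rfl⟩
    change polyCtxHom k a b (polyCtx c d g) ∈ reducibleSpan G q
    rw [polyCtx_eq, polyCtxHom_comp]
    refine Submodule.subset_span ⟨g, hg, lg, hl, a * c, d * b, ?_, rfl⟩
    rw [← ctx_ctx]
    exact hpq _ hp
  exact this hf

theorem exists_isLeading {f : WordAlg k Z} (hf : f ≠ 0) : ∃ t, IsLeading f t := by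
  have hne : f.coeff.support.Nonempty := by
    rw [Finsupp.support_nonempty_iff]
    exact fun h => hf (MonoidAlgebra.coeff_eq_zero.1 h)
  have : ∀ S : Finset (FreeSemigroup Z), S.Nonempty →
      ∃ t ∈ S, ∀ s ∈ S, s ≠ t → DlexLT s t := by
    intro S hS
    induction hS using Finset.Nonempty.cons_induction with
    | singleton a => exact ⟨a, by simp, by simp⟩
    | cons a S ha hS ih =>
      obtain ⟨t, ht, h⟩ := ih
      rcases dlexLT_trichotomous a t with h1 | h1 | h1
      · refine ⟨t, by simp [ht], fun s hs hst => ?_⟩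
        rcases Finset.mem_cons.1 hs with rfl | hs
        · exact h1
        · exact h s hs hst
      · exact absurd (h1 ▸ ht) ha
      · refine ⟨a, by simp, fun s hs hst => ?_⟩
        rcases Finset.mem_cons.1 hs with rfl | hs
        · exact absurd rfl hst
        · by_cases hst' : s = t
          · exact hst' ▸ h1
          · exact dlexLT_trans (h s hs hst') h1
  exact this _ hne

/-- The ideal generated by `G` is spanned by the polynomials `a g b`. -/
theorem span_le_reducibleSpan (G : Set (WordAlg k Z)) :
    (AlgIdeal.span (k := k) G).toSubmodule ≤ reducibleSpan G fun _ => True := by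
  refine sInf_le (show IsAlgIdeal (reducibleSpan G fun _ => True) ∧ G ⊆ (reducibleSpan G fun _ => True : Submodule k (WordAlg k Z)) from ⟨⟨fun r x hx => ?_, fun r x hx => ?_⟩, fun g hg => ?_⟩)
  · induction r using MonoidAlgebra.induction_linear with
    | zero => rw [zero_mul]; exact zero_mem _
    | add r s hr hs => rw [add_mul]; exact add_mem hr hs
    | single s c =>
      rw [single_eq_smul_single, smul_mul_assoc, single_mul_eq_polyCtxHom]
      exact Submodule.smul_mem _ _ (polyCtxHom_mem_reducibleSpan _ _ (fun _ _ => trivial) hx)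
  · induction r using MonoidAlgebra.induction_linear with
    | zero => rw [mul_zero]; exact zero_mem _
    | add r s hr hs => rw [mul_add]; exact add_mem hr hs
    | single s c =>
      rw [single_eq_smul_single, mul_smul_comm, mul_single_eq_polyCtxHom]
      exact Submodule.smul_mem _ _ (polyCtxHom_mem_reducibleSpan _ _ (fun _ _ => trivial) hx)
  · by_cases h0 : g = 0
    · rw [h0]; exact zero_mem _
    · obtain ⟨t, ht⟩ := exists_isLeading h0
      exact Submodule.subset_span ⟨g, hg, t, ht, 1, 1, trivial, (polyCtxHom_one_one g).symm⟩

variable [WellFoundedLT Z]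

/-- Each element of `A` is a linear combination of irreducible words. -/
theorem span_letter_irrS (G : Set (WordAlg k Z)) (I : AlgIdeal k (WordAlg k Z))
    (hG : G ⊆ I.toSubmodule) :
    Submodule.span k (Set.range fun u : IrrS G => letter I u) = ⊤ := by
  set W := Submodule.span k (Set.range fun u : IrrS G => letter I u) with hW
  have key : ∀ s : FreeSemigroup Z, letter I s ∈ W := by
    intro s
    induction s using (dlexLT_wf (Z := Z)).induction with
    | _ s ih =>
    by_cases hs : s ∈ IrrS G
    · exact Submodule.subset_span ⟨⟨s, hs⟩, rfl⟩
    · obtain ⟨g, hg, lg, hl, a, b, hab⟩ := not_not.1 hs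
      have hab' : s = ctx a b lg := WithOne.coe_injective (by rw [hab, coe_ctx])
      -- Modulo `I`, the monic multiple `a g b` vanishes, so the reducible word `s` is congruent to
      -- a combination of smaller words, which the induction hypothesis covers.
      have h1 := polyCtxHom_mem_lowerSpan hl.monic_sub_mem a b
      rw [map_sub, ← polyCtx_eq _ _ (MonoidAlgebra.single _ _), polyCtx_single, ← hab'] at h1
      have h2 : polyCtxHom k a b ((g.coeff lg)⁻¹ • g) ∈ I.toSubmodule :=
        polyCtxHom_mem_ideal I a b (Submodule.smul_mem _ _ (hG hg))
      have h3 : lowerSpan k s ≤ W.comap I.toQuot := by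
        refine Submodule.span_le.2 ?_
        rintro _ ⟨s', hs', rfl⟩
        exact ih s' hs'
      have h4 : I.toQuot (polyCtxHom k a b ((g.coeff lg)⁻¹ • g)) = 0 :=
        (Submodule.Quotient.mk_eq_zero _).2 h2
      have h5 := h3 h1
      rw [Submodule.mem_comap, map_sub, h4, zero_sub] at h5
      exact (Submodule.neg_mem_iff _).1 h5
  rw [eq_top_iff]
  rintro x -
  obtain ⟨x, rfl⟩ := I.toQuot_surjective x
  induction x using MonoidAlgebra.induction_linear with
  | zero => rw [map_zero]; exact zero_mem _
  | add x y hx hy => rw [map_add]; exact add_mem hx hy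
  | single s c =>
    rw [single_eq_smul_single, map_smul]
    exact Submodule.smul_mem _ _ (key s)

end Leading

/-! ### The composition-diamond lemma -/

section Diamond

variable {k : Type u} [Field k] {Z : Type v}

theorem mul_polyCtxHom_assoc (d : WithOne (FreeSemigroup Z)) (f g : WordAlg k Z) :
    f * polyCtxHom k d 1 g = polyCtxHom k 1 d f * g := by
  induction d using WithOne.recOneCoe with
  | one => rw [polyCtxHom_one_one, polyCtxHom_one_one]
  | coe d => rw [← single_mul_eq_polyCtxHom, ← mul_single_eq_polyCtxHom, mul_assoc]

variable [LinearOrder Z]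

/-- `g` divided by its coefficient at `t`. -/
noncomputable def monicAt (g : WordAlg k Z) (t : FreeSemigroup Z) : WordAlg k Z :=
  (g.coeff t)⁻¹ • g

theorem polyCtxHom_monicAt_mem {G : Set (WordAlg k Z)} {p : FreeSemigroup Z → Prop}
    {g : WordAlg k Z} {l : FreeSemigroup Z} (hg : g ∈ G) (hl : IsLeading g l)
    {a b : WithOne (FreeSemigroup Z)} (hp : p (ctx a b l)) :
    polyCtxHom k a b (monicAt g l) ∈ reducibleSpan G p := by
  rw [monicAt, map_smul]
  exact Submodule.smul_mem _ _ (Submodule.subset_span ⟨g, hg, l, hl, a, b, hp, rfl⟩)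

variable {G : Set (WordAlg k Z)} {g₁ g₂ : WordAlg k Z} {l₁ l₂ : FreeSemigroup Z}

/-- Two leading monomials which do not overlap give a trivial composition. -/
theorem disjoint_composition_mem (hg₁ : g₁ ∈ G) (hg₂ : g₂ ∈ G) (hl₁ : IsLeading g₁ l₁)
    (hl₂ : IsLeading g₂ l₂) (d : WithOne (FreeSemigroup Z)) :
    polyCtxHom k 1 (d * WithOne.coe l₂) (monicAt g₁ l₁)
      - polyCtxHom k (WithOne.coe l₁ * d) 1 (monicAt g₂ l₂)
      ∈ reducibleSpan G fun s => DlexLT s (ctx (WithOne.coe l₁ * d) 1 l₂) := by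
  set p : FreeSemigroup Z → Prop := fun s => DlexLT s (ctx (WithOne.coe l₁ * d) 1 l₂) 
  have h1 : ∀ r ∈ lowerSpan k l₁, r * polyCtxHom k d 1 (monicAt g₂ l₂) ∈ reducibleSpan G p := by
    intro r hr
    induction hr using Submodule.span_induction with
    | mem x hx =>
      obtain ⟨s, hs, rfl⟩ := hx
      change MonoidAlgebra.single s 1 * _ ∈ reducibleSpan G p
      rw [single_mul_eq_polyCtxHom, polyCtxHom_comp, one_mul]
      refine polyCtxHom_monicAt_mem hg₂ hl₂ ?_
      change DlexLT _ _
      rw [dlexLT_iff, coe_ctx, coe_ctx, mul_one, mul_one, mul_assoc, mul_assoc]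
      simpa using wordLT_mul (dlexLT_iff.1 hs) 1 (d * WithOne.coe l₂)
    | zero => rw [zero_mul]; exact zero_mem _
    | add x y _ _ hx hy => rw [add_mul]; exact add_mem hx hy
    | smul c x _ hx => rw [smul_mul_assoc]; exact Submodule.smul_mem _ _ hx
  have h2 : ∀ r ∈ lowerSpan k l₂, polyCtxHom k 1 d (monicAt g₁ l₁) * r ∈ reducibleSpan G p := by
    intro r hr
    induction hr using Submodule.span_induction with
    | mem x hx =>
      obtain ⟨s, hs, rfl⟩ := hx
      change _ * MonoidAlgebra.single s 1 ∈ reducibleSpan G p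
      rw [mul_single_eq_polyCtxHom, polyCtxHom_comp, one_mul]
      refine polyCtxHom_monicAt_mem hg₁ hl₁ ?_
      change DlexLT _ _
      rw [dlexLT_iff, coe_ctx, coe_ctx, one_mul, mul_one, ← mul_assoc]
      simpa using wordLT_mul (dlexLT_iff.1 hs) (WithOne.coe l₁ * d) 1
    | zero => rw [mul_zero]; exact zero_mem _
    | add x y _ _ hx hy => rw [mul_add]; exact add_mem hx hy
    | smul c x _ hx => rw [mul_smul_comm]; exact Submodule.smul_mem _ _ hx
  -- With monic `g₁`, `g₂` this is `(g₁ - l₁) d g₂ - g₁ d (g₂ - l₂) = g₁ d l₂ - l₁ d g₂`; on the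
  -- left the term `g₁ d g₂` cancels and only words smaller than `l₁ d l₂` lead.
  have h := sub_mem (h1 _ hl₁.monic_sub_mem) (h2 _ hl₂.monic_sub_mem)
  change (monicAt g₁ l₁ - _) * _ - _ * (monicAt g₂ l₂ - _) ∈ reducibleSpan G p at h
  rw [sub_mul, mul_sub, mul_polyCtxHom_assoc, single_mul_eq_polyCtxHom, mul_single_eq_polyCtxHom,
    polyCtxHom_comp, polyCtxHom_comp, sub_sub_sub_cancel_left] at h
  exact h

variable {I : AlgIdeal k (WordAlg k Z)} (hG : IsGSBasis G I)

include hG in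
theorem inclusion_composition_mem (hg₁ : g₁ ∈ G) (hg₂ : g₂ ∈ G) (hl₁ : IsLeading g₁ l₁)
    (hl₂ : IsLeading g₂ l₂) {a b : WithOne (FreeSemigroup Z)} (h : l₁ = ctx a b l₂) :
    monicAt g₁ l₁ - polyCtxHom k a b (monicAt g₂ l₂) ∈ reducibleSpan G fun s => DlexLT s l₁ := by
  have := (hG.2 g₁ hg₁ g₂ hg₂ l₁ l₂ hl₁ hl₂).2 a b h
  rw [polyCtx_eq, ← map_smul] at this
  exact this

/-- The occurrence of `l₁` begins the common word, so only the position of `l₂` varies: it starts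
after `l₁` ends (disjoint), it ends at or after the end of `l₁` while starting within it (overlap),
or it lies inside `l₁` (inclusion). Each case is a composition multiplied by a context. -/
theorem composition_mem_of_prefix (hG : IsGSBasis G I) (hg₁ : g₁ ∈ G) (hg₂ : g₂ ∈ G)
    (hl₁ : IsLeading g₁ l₁) (hl₂ : IsLeading g₂ l₂) {b₁ e b₂ : WithOne (FreeSemigroup Z)}
    (h : WithOne.coe l₁ * b₁ = e * WithOne.coe l₂ * b₂) :
    polyCtxHom k 1 b₁ (monicAt g₁ l₁) - polyCtxHom k e b₂ (monicAt g₂ l₂)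
      ∈ reducibleSpan G fun s => DlexLT s (ctx e b₂ l₂) := by
  rw [mul_assoc] at h
  have disj : ∀ d, e = WithOne.coe l₁ * d → b₁ = d * (WithOne.coe l₂ * b₂) →
      polyCtxHom k 1 b₁ (monicAt g₁ l₁) - polyCtxHom k e b₂ (monicAt g₂ l₂)
        ∈ reducibleSpan G fun s => DlexLT s (ctx e b₂ l₂) := by
    rintro d rfl rfl
    have := polyCtxHom_mem_reducibleSpan (q := fun s => DlexLT s (ctx (WithOne.coe l₁ * d) b₂ l₂))
      1 b₂ (fun s hs => ?_) (disjoint_composition_mem hg₁ hg₂ hl₁ hl₂ d)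
    · rwa [map_sub, polyCtxHom_comp, polyCtxHom_comp, one_mul, one_mul, one_mul, mul_assoc] at this
    · have := ctx_lt hs 1 b₂
      rwa [ctx_ctx, one_mul, one_mul] at this
  rcases exists_of_mul_eq_mul h with ⟨d, h1, h2⟩ | ⟨d, h1, h2⟩
  · exact disj d h1 h2
  rcases exists_of_mul_eq_mul h2.symm with ⟨x, h3, rfl⟩ | ⟨x, rfl, rfl⟩
  · suffices h5 : polyCtxHom k 1 x (monicAt g₁ l₁) - polyCtxHom k e 1 (monicAt g₂ l₂)
        ∈ reducibleSpan G fun s => DlexLT s (ctx e 1 l₂) by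
      have := polyCtxHom_mem_reducibleSpan (q := fun s => DlexLT s (ctx e b₂ l₂))
        1 b₂ (fun s hs => ?_) h5
      · rwa [map_sub, polyCtxHom_comp, polyCtxHom_comp, one_mul, one_mul, one_mul] at this
      · have := ctx_lt hs 1 b₂
        rwa [ctx_ctx, one_mul, one_mul] at this
    -- Here `l₁ = e d` and `l₂ = d x`. An empty `d` means adjacent leading words, an empty `e` or
    -- `x` means that one leading word contains the other; only when all three are nonempty is there
    -- a proper intersection.
    induction d using WithOne.recOneCoe with
    | one =>
      rw [mul_one] at h1
      rw [one_mul] at h3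
      subst h3
      rw [← h1]
      simpa using disjoint_composition_mem hg₁ hg₂ hl₁ hl₂ 1
    | coe d =>
    induction e using WithOne.recOneCoe with
    | one =>
      rw [one_mul, WithOne.coe_inj] at h1
      subst h1
      have h4 : l₂ = ctx 1 x l₁ := WithOne.coe_injective (by rw [h3, coe_ctx, one_mul])
      rw [← Submodule.neg_mem_iff, neg_sub, polyCtxHom_one_one]
      exact inclusion_composition_mem hG hg₂ hg₁ hl₂ hl₁ h4
    | coe e =>
    induction x using WithOne.recOneCoe with
    | one =>
      rw [mul_one, WithOne.coe_inj] at h3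
      subst h3
      have h4 : l₁ = ctx (WithOne.coe e) 1 l₂ :=
        WithOne.coe_injective (by rw [h1, coe_ctx, mul_one])
      rw [polyCtxHom_one_one, ← h4]
      exact inclusion_composition_mem hG hg₁ hg₂ hl₁ hl₂ h4
    | coe x =>
      rw [← WithOne.coe_mul, WithOne.coe_inj] at h1 h3
      have h6 : l₁ * x = e * l₂ := by rw [h1, h3, mul_assoc]
      -- The two length conditions of an intersection composition hold because `e` and `x` are
      -- nonempty, respectively because `d` is.
      have := (hG.2 g₁ hg₁ g₂ hg₂ l₁ l₂ hl₁ hl₂).1 (l₁ * x) x e rfl h6 ?_ ?_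
      · have h7 : ctx (WithOne.coe e) 1 l₂ = l₁ * x := h6.symm
        rw [h7, ← mul_single_eq_polyCtxHom, ← single_mul_eq_polyCtxHom, monicAt, monicAt,
          smul_mul_assoc, mul_smul_comm]
        exact this
      · have h8 : x.length = x.tail.length + 1 := rfl
        have h9 : e.length = e.tail.length + 1 := rfl
        simp only [h1, h3, FreeSemigroup.length_mul]
        omega
      · have h8 : d.length = d.tail.length + 1 := rfl
        simp only [h1, h3, FreeSemigroup.length_mul]
        omega
  · have h4 : l₁ = ctx e x l₂ := WithOne.coe_injective (by rw [h1, coe_ctx, mul_assoc])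
    have := polyCtxHom_mem_reducibleSpan (q := fun s => DlexLT s (ctx e (x * b₁) l₂))
      1 b₁ (fun s hs => ?_) (inclusion_composition_mem hG hg₁ hg₂ hl₁ hl₂ h4)
    · rwa [map_sub, polyCtxHom_comp, one_mul] at this
    · have := ctx_lt hs 1 b₁
      rwa [h4, ctx_ctx, one_mul] at this

/-- One of the contexts `a₁`, `a₂` is a prefix of the other; splitting it off on the left reduces to
`composition_mem_of_prefix`, with the two roles exchanged in the second case. -/
theorem composition_mem (hG : IsGSBasis G I) (hg₁ : g₁ ∈ G) (hg₂ : g₂ ∈ G)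
    (hl₁ : IsLeading g₁ l₁) (hl₂ : IsLeading g₂ l₂) {a₁ b₁ a₂ b₂ : WithOne (FreeSemigroup Z)}
    (h : ctx a₁ b₁ l₁ = ctx a₂ b₂ l₂) :
    polyCtxHom k a₁ b₁ (monicAt g₁ l₁) - polyCtxHom k a₂ b₂ (monicAt g₂ l₂)
      ∈ reducibleSpan G fun s => DlexLT s (ctx a₂ b₂ l₂) := by
  have h' := congrArg WithOne.coe h
  rw [coe_ctx, coe_ctx, mul_assoc, mul_assoc] at h'
  rcases exists_of_mul_eq_mul h' with ⟨e, rfl, h1⟩ | ⟨e, rfl, h1⟩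
  · rw [← mul_assoc] at h1
    have := polyCtxHom_mem_reducibleSpan (q := fun s => DlexLT s (ctx (a₁ * e) b₂ l₂))
      a₁ 1 (fun s hs => ?_) (composition_mem_of_prefix hG hg₁ hg₂ hl₁ hl₂ h1)
    · rwa [map_sub, polyCtxHom_comp, polyCtxHom_comp, mul_one, mul_one, mul_one] at this
    · have := ctx_lt hs a₁ 1
      rwa [ctx_ctx, mul_one] at this
  · rw [← mul_assoc] at h1
    have := polyCtxHom_mem_reducibleSpan (q := fun s => DlexLT s (ctx (a₂ * e) b₁ l₁))
      a₂ 1 (fun s hs => ?_) (composition_mem_of_prefix hG hg₂ hg₁ hl₂ hl₁ h1)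
    · rw [map_sub, polyCtxHom_comp, polyCtxHom_comp, mul_one, mul_one, mul_one, h] at this
      rw [← Submodule.neg_mem_iff, neg_sub]
      exact this
    · have := ctx_lt hs a₂ 1
      rwa [ctx_ctx, mul_one] at this

/-- Multiplication by a context preserves the order, so no monomial of `a g b` exceeds its leading
word. -/
theorem reducibleSpan_lt_le_lowerSpan (t : FreeSemigroup Z) :
    (reducibleSpan G fun s => DlexLT s t) ≤ lowerSpan k t := by
  refine Submodule.span_le.2 ?_
  rintro _ ⟨g, hg, l, hl, a, b, hp, rfl⟩
  refine mem_lowerSpan_of_forall fun s hs => ?_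
  obtain ⟨s', hs', rfl⟩ : ∃ s' ∈ g.coeff.support, ctx a b s' = s := by
    classical
    have := Finsupp.mapDomain_support (f := ctx a b) (s := g.coeff) hs
    simpa using this
  by_cases h : s' = l
  · exact h ▸ hp
  · exact dlexLT_trans (ctx_lt (hl.2 s' hs' h) a b) hp

/-- Only finitely many generators occur and the order is total, so one leading word bounds the
others. This supplies the bound for the well-founded induction in `eq_zero_of_mem_reducibleSpan`. -/
theorem exists_mem_reducibleSpan_le {p : FreeSemigroup Z → Prop} {f : WordAlg k Z}
    (hf : f ∈ reducibleSpan G p) :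
    f = 0 ∨ ∃ t, p t ∧ f ∈ reducibleSpan G fun s => s = t ∨ DlexLT s t := by
  induction hf using Submodule.span_induction with
  | mem x hx =>
    obtain ⟨g, hg, l, hl, a, b, hp, rfl⟩ := hx
    exact Or.inr ⟨_, hp, Submodule.subset_span ⟨g, hg, l, hl, a, b, Or.inl rfl, rfl⟩⟩
  | zero => exact Or.inl rfl
  | add x y _ _ hx hy =>
    rcases hx with rfl | ⟨t, ht, hx⟩
    · rwa [zero_add]
    rcases hy with rfl | ⟨t', ht', hy⟩
    · rw [add_zero]; exact Or.inr ⟨t, ht, hx⟩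
    right
    rcases dlexLT_trichotomous t t' with h | rfl | h
    · refine ⟨t', ht', add_mem (reducibleSpan_mono G ?_ hx) hy⟩
      rintro s (rfl | hs)
      · exact Or.inr h
      · exact Or.inr (dlexLT_trans hs h)
    · exact ⟨t, ht, add_mem hx hy⟩
    · refine ⟨t, ht, add_mem hx (reducibleSpan_mono G ?_ hy)⟩
      rintro s (rfl | hs)
      · exact Or.inr h
      · exact Or.inr (dlexLT_trans hs h)
  | smul c x _ hx =>
    rcases hx with rfl | ⟨t, ht, hx⟩
    · exact Or.inl (smul_zero _)
    · exact Or.inr ⟨t, ht, Submodule.smul_mem _ _ hx⟩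

theorem polyCtxHom_monicAt_coeff (g : WordAlg k Z) (l : FreeSemigroup Z) (hl : IsLeading g l)
    (a b : WithOne (FreeSemigroup Z)) :
    (polyCtxHom k a b (monicAt g l)).coeff (ctx a b l) = 1 := by
  have h1 := polyCtxHom_mem_lowerSpan hl.monic_sub_mem a b
  have h2 := coeff_eq_zero_of_mem_lowerSpan h1 (dlexLT_irrefl _)
  rw [map_sub, ← polyCtx_eq _ _ (MonoidAlgebra.single _ _), polyCtx_single,
    MonoidAlgebra.coeff_sub, Finsupp.sub_apply, MonoidAlgebra.coeff_single,
    Finsupp.single_eq_same, sub_eq_zero] at h2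
  exact h2

variable [WellFoundedLT Z]

/-- A polynomial which is reducible to zero and only involves irreducible words vanishes. -/
theorem eq_zero_of_mem_reducibleSpan (hG : IsGSBasis G I) (t : FreeSemigroup Z) :
    ∀ f ∈ reducibleSpan G fun s => s = t ∨ DlexLT s t,
      (∀ s, s ∉ IrrS G → f.coeff s = 0) → f = 0 := by
  induction t using (dlexLT_wf (Z := Z)).induction with
  | _ t ih =>
  intro f hf hirr
  suffices h : f ∈ reducibleSpan G fun s => DlexLT s t by
    rcases exists_mem_reducibleSpan_le h with h | ⟨t', ht', h⟩
    · exact h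
    · exact ih t' ht' f h hirr
  by_cases ht : ∃ g ∈ G, ∃ l, IsLeading g l ∧ ∃ a b, t = ctx a b l
  · obtain ⟨g₀, hg₀, l₀, hl₀, a₀, b₀, rfl⟩ := ht
    -- Triviality of compositions makes all monic generators with the maximal leading word congruent
    -- modulo smaller ones, so a single representative suffices.
    have h1 : (reducibleSpan G fun s => s = ctx a₀ b₀ l₀ ∨ DlexLT s (ctx a₀ b₀ l₀)) ≤
        Submodule.span k {polyCtxHom k a₀ b₀ (monicAt g₀ l₀)} ⊔
          reducibleSpan G fun s => DlexLT s (ctx a₀ b₀ l₀) := by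
      refine Submodule.span_le.2 ?_
      rintro _ ⟨g, hg, l, hl, a, b, h | h, rfl⟩
      · have h2 := composition_mem hG hg hg₀ hl hl₀ h
        have h3 : polyCtx a b g = g.coeff l • polyCtxHom k a b (monicAt g l) := by
          rw [monicAt, map_smul, smul_smul, mul_inv_cancel₀ hl.coeff_ne_zero, one_smul]; rfl
        rw [h3]
        refine Submodule.smul_mem _ _ ?_
        rw [← sub_add_cancel (polyCtxHom k a b (monicAt g l))
          (polyCtxHom k a₀ b₀ (monicAt g₀ l₀))]
        exact add_mem (Submodule.mem_sup_right h2)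
          (Submodule.mem_sup_left (Submodule.mem_span_singleton_self _))
      · exact Submodule.mem_sup_right (Submodule.subset_span ⟨g, hg, l, hl, a, b, h, rfl⟩)
    obtain ⟨x, hx, y, hy, rfl⟩ := Submodule.mem_sup.1 (h1 hf)
    obtain ⟨c, rfl⟩ := Submodule.mem_span_singleton.1 hx
    -- The coefficient of `f` at the maximal word is the multiplier `c` of that representative,
    -- since the remaining terms are smaller. The word is reducible, so `c = 0`.
    have h2 := hirr (ctx a₀ b₀ l₀) (not_not.2 ⟨g₀, hg₀, l₀, hl₀, a₀, b₀, coe_ctx _ _ _⟩)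
    have h3 := coeff_eq_zero_of_mem_lowerSpan (reducibleSpan_lt_le_lowerSpan _ hy)
      (dlexLT_irrefl _)
    rw [MonoidAlgebra.coeff_add, Finsupp.add_apply, h3, add_zero, MonoidAlgebra.coeff_smul,
      Finsupp.smul_apply, polyCtxHom_monicAt_coeff _ _ hl₀, smul_eq_mul, mul_one] at h2
    rw [h2, zero_smul, zero_add]
    exact hy
  · refine (Submodule.span_mono ?_) hf
    rintro _ ⟨g, hg, l, hl, a, b, h | h, rfl⟩
    · exact absurd ⟨g, hg, l, hl, a, b, h.symm⟩ ht
    · exact ⟨g, hg, l, hl, a, b, h, rfl⟩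

/-- A combination of irreducible words that lies in `I` is a combination of polynomials `a g b`, and
`eq_zero_of_mem_reducibleSpan` makes it vanish. -/
theorem linearIndependent_letter_irrS (hG : IsGSBasis G I) :
    LinearIndependent k (fun u : IrrS G => letter I u) := by
  refine LinearIndependent.map (v := fun u : IrrS G => (MonoidAlgebra.single (u : FreeSemigroup Z) 1
    : WordAlg k Z)) (f := I.toQuot) ?_ ?_
  · have h : LinearIndependent k fun u : IrrS G =>
        (Finsupp.single (u : FreeSemigroup Z) 1 : FreeSemigroup Z →₀ k) :=
      (Finsupp.linearIndependent_single_one k (FreeSemigroup Z)).comp _ Subtype.val_injective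
    exact LinearIndependent.of_comp (MonoidAlgebra.coeffLinearEquiv k).toLinearMap h
  · rw [Submodule.disjoint_def]
    intro f hf hf'
    have h1 : f ∈ I.toSubmodule := (Submodule.Quotient.mk_eq_zero _).1 hf'
    rw [← hG.1] at h1
    rcases exists_mem_reducibleSpan_le (span_le_reducibleSpan G h1) with h | ⟨t, -, h⟩
    · exact h
    refine eq_zero_of_mem_reducibleSpan hG t f h fun s hs => ?_
    clear h h1 hf'
    induction hf using Submodule.span_induction with
    | mem x hx =>
      obtain ⟨u, rfl⟩ := hx
      have : (u : FreeSemigroup Z) ≠ s := by rintro rfl; exact hs u.2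
      simp [this]
    | zero => rfl
    | add x y _ _ hx hy => simp [hx, hy]
    | smul c x _ hx => simp [hx]

/-- The irreducible words form a basis of the algebra `k𝒮(Z) / I`. -/
noncomputable def irrBasis (hG : IsGSBasis G I) : Module.Basis (IrrS G) k I.Quot :=
  Module.Basis.mk (linearIndependent_letter_irrS hG)
    (span_letter_irrS G I (by rw [← hG.1]; exact subset_span G)).ge

theorem irrBasis_apply (hG : IsGSBasis G I) (u : IrrS G) : irrBasis hG u = letter I u := by
  rw [irrBasis, Module.Basis.mk_apply]

end Diamond

/-! ### Actions on words -/

section Action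

variable {k : Type*} [Field k] {A : Type*} [AddCommGroup A] [Module k A] {X Λ : Type*}
  (b : Module.Basis X k A) (m : A →ₗ[k] A →ₗ[k] A) (e : X → Λ) (d : Λ → Option X)

/-- The linear map `a ↦ a l` for a list `l`, where the elements of a basis are letters. -/
noncomputable def prepend (l : List Λ) : A →ₗ[k] (List Λ →₀ k) :=
  b.constr k fun x => Finsupp.single (e x :: l) 1

theorem prepend_basis (l : List Λ) (x : X) :
    prepend b e l (b x) = Finsupp.single (e x :: l) 1 := b.constr_basis _ _ _

/-- The product of an element with a list: the first letter of the list is multiplied by the element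
if it belongs to the given basis, otherwise the element is prepended. -/
noncomputable def actList : List Λ → (A →ₗ[k] (List Λ →₀ k))
  | [] => prepend b e []
  | a :: l => match d a with
    | some x => prepend b e l ∘ₗ m.flip (b x)
    | none => prepend b e (a :: l)

/-- The action on linear combinations of lists. -/
noncomputable def actEnd : A →ₗ[k] Module.End k (List Λ →₀ k) :=
  LinearMap.flip (Finsupp.linearCombination k (actList b m e d))

theorem actEnd_single (a : A) (l : List Λ) :
    actEnd b m e d a (Finsupp.single l 1) = actList b m e d l a := by
  simp [actEnd, LinearMap.flip_apply]

variable {d} (hd : ∀ x, d (e x) = some x) (hm : ∀ x y z, m (m x y) z = m x (m y z))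

include hd in
-- On a basis element `b x` the list `e x :: l` has a first letter that decodes to `x`, so the
-- action multiplies into it. Nothing is required of `l`.
theorem actEnd_prepend (a a' : A) (l : List Λ) :
    actEnd b m e d a (prepend b e l a') = prepend b e l (m a a') := by
  have : actEnd b m e d a ∘ₗ prepend b e l = prepend b e l ∘ₗ m a := by
    refine b.ext fun x => ?_
    rw [LinearMap.comp_apply, prepend_basis, actEnd_single, actList, hd]
    rfl
  exact LinearMap.congr_fun this a'

include hd hm in
-- After the first factor has acted, the list starts with a basis letter, so the second factor
-- multiplies into it by `actEnd_prepend`; associativity of `m` is needed only if such a letter was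
-- there from the start.
theorem actEnd_mul (a a' : A) : actEnd b m e d (m a a') = actEnd b m e d a * actEnd b m e d a' := by
  refine Finsupp.lhom_ext' fun l => LinearMap.ext_ring ?_
  change actEnd b m e d (m a a') (Finsupp.single l 1)
    = actEnd b m e d a (actEnd b m e d a' (Finsupp.single l 1))
  rw [actEnd_single, actEnd_single]
  rcases l with _ | ⟨x, l⟩
  · rw [actList, actEnd_prepend b m e hd]
  · rw [actList]
    split
    · rw [LinearMap.comp_apply, LinearMap.comp_apply, LinearMap.flip_apply, LinearMap.flip_apply,
        actEnd_prepend b m e hd, hm]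
    · rw [actEnd_prepend b m e hd]

theorem actEnd_basis_single (x : X) {l : List Λ} (hl : ∀ a ∈ l.head?, d a = none) :
    actEnd b m e d (b x) (Finsupp.single l 1) = Finsupp.single (e x :: l) 1 := by
  rw [actEnd_single]
  rcases l with _ | ⟨a, l⟩
  · rw [actList, prepend_basis]
  · rw [actList, hl a rfl, prepend_basis]

end Action

section Independence

variable {k : Type*} [Field k]

/-- Words whose classes are mapped to distinct basis vectors are linearly independent. -/
theorem linearIndependent_of_decode {V W S Y : Type*} [AddCommGroup V] [Module k V]
    (B : Set W) (f : W → V) (Φ : V →ₗ[k] (Y →₀ k)) (ι : W → S) (hι : Function.Injective ι)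
    (dec : Y → S) (h : ∀ t : B, ∃ l, Φ (f t) = Finsupp.single l 1 ∧ dec l = ι t) :
    LinearIndependent k fun t : B => f t := by
  choose l hl1 hl2 using h
  refine LinearIndependent.of_comp Φ ?_
  have : (Φ ∘ fun t : B => f t) = fun t : B => Finsupp.single (l t) (1 : k) :=
    funext hl1
  rw [this]
  refine (Finsupp.linearIndependent_single_one k Y).comp l fun s t hst => ?_
  refine Subtype.ext (hι ?_)
  rw [← hl2 s, ← hl2 t]
  exact congrArg dec hst

end Independence

/-! ### Nested words: the second and the third group of identities -/

section Tw

/-- The product of two elements in the given order, or in the opposite order. -/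
def tw {S : Type*} [Mul S] (σ : Bool) (x y : S) : S := bif σ then x * y else y * x

theorem tw_assoc {S : Type*} [Semigroup S] (σ : Bool) (x y z : S) :
    tw σ (tw σ x y) z = tw σ x (tw σ y z) := by
  cases σ
  · exact (mul_assoc z y x).symm
  · exact mul_assoc x y z

theorem map_tw {S T : Type*} [Mul S] [Mul T] (σ : Bool) (f : S → T)
    (hf : ∀ x y, f (x * y) = f x * f y) (x y : S) : f (tw σ x y) = tw σ (f x) (f y) := by
  cases σ <;> exact hf _ _

variable {k : Type*} [Field k] {C : Type*} [NonUnitalRing C] [Module k C]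
  [IsScalarTower k C C] [SMulCommClass k C C]

variable (k C) in
/-- `tw` as a bilinear map. -/
noncomputable def twLin (σ : Bool) : C →ₗ[k] C →ₗ[k] C :=
  bif σ then LinearMap.mul k C else (LinearMap.mul k C).flip

theorem twLin_apply (σ : Bool) (x y : C) : twLin k C σ x y = tw σ x y := by
  cases σ <;> rfl

theorem tw_smul_left (σ : Bool) (c : k) (x y : C) : tw σ (c • x) y = c • tw σ x y := by
  rw [← twLin_apply (k := k), map_smul, LinearMap.smul_apply, twLin_apply]

theorem tw_smul_right (σ : Bool) (c : k) (x y : C) : tw σ x (c • y) = c • tw σ x y := by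
  rw [← twLin_apply (k := k), map_smul, twLin_apply]

/-- The operator `x ↦ x p - p x + lam x`. -/
noncomputable def commutatorOp (p : C) (lam : k) : C →ₗ[k] C :=
  LinearMap.mulRight k p - LinearMap.mulLeft k p + lam • LinearMap.id

/-- The commutator with `p` is a derivation, and adding `lam` times the identity accounts for the
term `lam xy`. -/
theorem isPhiAlgebra_commutatorOp (p : C) (lam : k) :
    IsPhiAlgebra (opiN1b lam) (commutatorOp p lam) := by
  intro r
  have h : ∀ c, commutatorOp p lam c = c * p - p * c + lam • c := fun _ => rfl
  rw [← evalHom_eq, evalHom_opiN1b]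
  simp only [h, mul_add, mul_sub, add_mul, sub_mul, mul_smul_comm, smul_mul_assoc, mul_assoc]
  abel

end Tw

section Nest

variable {k : Type u} [Field k] {Z : Type v} [LinearOrder Z]

/-- Nested words, with the words `uᵢ` on the left or on the right of the brackets. -/
def nest (σ : Bool) (p : FreeSemigroup Z × ℕ) : List (FreeSemigroup Z × ℕ) → BWord Z
  | [] => BWord.br^[p.2] (BWord.ofWord p.1)
  | q :: l => BWord.br^[p.2] (tw σ (BWord.ofWord p.1) (nest σ q l))

omit [LinearOrder Z] in
theorem leftNest_eq (p : FreeSemigroup Z × ℕ) (l : List (FreeSemigroup Z × ℕ)) :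
    leftNest p l = nest false p l := by
  induction l generalizing p with
  | nil => rfl
  | cons q l ih => rw [leftNest, ih, nest]; rfl

omit [LinearOrder Z] in
theorem rightNest_eq (p : FreeSemigroup Z × ℕ) (l : List (FreeSemigroup Z × ℕ)) :
    rightNest p l = nest true p l := by
  induction l generalizing p with
  | nil => rfl
  | cons q l ih => rw [rightNest, ih, nest]; rfl

/-- The irreducible nested words. -/
def nestWords (σ : Bool) (G : Set (WordAlg k Z)) : Set (BWord Z) :=
  {t | (∃ u ∈ IrrS G, t = BWord.ofWord u) ∨
    ∃ p l, (∀ q ∈ p :: l, q.1 ∈ IrrS G ∧ 1 ≤ q.2) ∧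
      (t = nest σ p l ∨ ∃ u ∈ IrrS G, t = tw σ (BWord.ofWord u) (nest σ p l))}

theorem one_mem_irrM (G : Set (WordAlg k Z)) : (1 : WithOne (FreeSemigroup Z)) ∈ IrrM G := by
  rintro ⟨g, hg, l, hl, a, b, h⟩
  have := congrArg letters h
  simp at this

theorem coe_mem_irrM {G : Set (WordAlg k Z)} {u : FreeSemigroup Z} :
    WithOne.coe u ∈ IrrM G ↔ u ∈ IrrS G := Iff.rfl

omit [LinearOrder Z] in
theorem ofWordM_coe (u : FreeSemigroup Z) :
    BWord.ofWordM (WithOne.coe u) = WithOne.coe (BWord.ofWord u) := rfl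

theorem basis2_eq (G : Set (WordAlg k Z)) : basis2 G = nestWords false G := by
  ext t
  constructor
  · rintro (⟨u, hu, rfl⟩ | ⟨a, ha, p, l, h, ht⟩)
    · exact Or.inl ⟨u, hu, rfl⟩
    · refine Or.inr ⟨p, l, h, ?_⟩
      rw [leftNest_eq] at ht
      induction a using WithOne.recOneCoe with
      | one => exact Or.inl (WithOne.coe_injective (by simpa using ht))
      | coe u => exact Or.inr ⟨u, ha, WithOne.coe_injective ht⟩
  · rintro (⟨u, hu, rfl⟩ | ⟨p, l, h, rfl | ⟨u, hu, rfl⟩⟩)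
    · exact Or.inl ⟨u, hu, rfl⟩
    · exact Or.inr ⟨1, one_mem_irrM G, p, l, h, by rw [leftNest_eq]; simp⟩
    · exact Or.inr ⟨WithOne.coe u, hu, p, l, h, by rw [leftNest_eq]; rfl⟩

theorem basis3_eq (G : Set (WordAlg k Z)) : basis3 G = nestWords true G := by
  ext t
  constructor
  · rintro (⟨u, hu, rfl⟩ | ⟨a, ha, p, l, h, ht⟩)
    · exact Or.inl ⟨u, hu, rfl⟩
    · refine Or.inr ⟨p, l, h, ?_⟩
      rw [rightNest_eq] at ht
      induction a using WithOne.recOneCoe with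
      | one => exact Or.inl (WithOne.coe_injective (by simpa using ht))
      | coe u => exact Or.inr ⟨u, ha, WithOne.coe_injective ht⟩
  · rintro (⟨u, hu, rfl⟩ | ⟨p, l, h, rfl | ⟨u, hu, rfl⟩⟩)
    · exact Or.inl ⟨u, hu, rfl⟩
    · exact Or.inr ⟨1, one_mem_irrM G, p, l, h, by rw [rightNest_eq]; simp⟩
    · exact Or.inr ⟨WithOne.coe u, hu, p, l, h, by rw [rightNest_eq]; rfl⟩

/-- A further bracket starts a nest on an irreducible word, raises the outermost exponent of a nest,
or opens a new level when an irreducible factor stands outside. -/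
theorem br_mem_nestWords {σ : Bool} {G : Set (WordAlg k Z)} {t : BWord Z} (ht : t ∈ nestWords σ G) :
    t.br ∈ nestWords σ G := by
  right
  rcases ht with ⟨u, hu, rfl⟩ | ⟨p, l, h, rfl | ⟨u, hu, rfl⟩⟩
  · exact ⟨(u, 1), [], by simpa using hu, Or.inl rfl⟩
  · refine ⟨(p.1, p.2 + 1), l, ?_, Or.inl ?_⟩
    · intro q hq
      rcases List.mem_cons.1 hq with rfl | hq
      · exact ⟨(h p (by simp)).1, by simp⟩
      · exact h q (by simp [hq])
    · cases l <;> simp only [nest, Function.iterate_succ_apply']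
  · refine ⟨(u, 1), p :: l, ?_, Or.inl rfl⟩
    intro q hq
    rcases List.mem_cons.1 hq with rfl | hq
    · exact ⟨hu, le_rfl⟩
    · exact h q hq

/-! #### Nested words span -/

section Span

variable {φ : OPI k} {I : AlgIdeal k (WordAlg k Z)} {G : Set (WordAlg k Z)}

theorem linearMap_quot_mem (hA : Submodule.span k (Set.range fun u : IrrS G => letter I u) = ⊤)
    {F : Type*} [AddCommGroup F] [Module k F] (f : I.Quot →ₗ[k] F) (W : Submodule k F)
    (h : ∀ u ∈ IrrS G, f (letter I u) ∈ W) (a : I.Quot) : f a ∈ W := by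
  have : Submodule.span k (Set.range fun u : IrrS G => letter I u) ≤ W.comap f := by
    refine Submodule.span_le.2 ?_
    rintro _ ⟨u, rfl⟩
    exact h u u.2
  exact this (hA ▸ Submodule.mem_top)

/-- It suffices that twisted multiplication by every word preserves the span `W`. The hypothesis
`hP` expresses multiplication by `⌊x⌋` through multiplication by `x` and the operator, both of which
preserve `W`, so an induction on the word applies. -/
theorem span_nestWords (σ : Bool) (α β : k)
    (hA : Submodule.span k (Set.range fun u : IrrS G => letter I u) = ⊤)
    (hP : ∀ x y : FreePhiAlg φ I, tw σ (freeOp φ I x) y =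
      freeOp φ I (tw σ x y) + α • tw σ x (freeOp φ I y) + β • tw σ x y) :
    Submodule.span k (Set.range fun t : nestWords σ G => wordClass φ I t) = ⊤ := by
  set W := Submodule.span k (Set.range fun t : nestWords σ G => wordClass φ I t) with hW
  set T := twLin k (FreePhiAlg φ I) σ with hT
  have hTa : ∀ x y, T x y = tw σ x y := twLin_apply σ
  have hmem : ∀ t ∈ nestWords σ G, wordClass φ I t ∈ W := fun t ht =>
    Submodule.subset_span ⟨⟨t, ht⟩, rfl⟩
  have hind : ∀ (g : FreePhiAlg φ I →ₗ[k] FreePhiAlg φ I),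
      (∀ t ∈ nestWords σ G, g (wordClass φ I t) ∈ W) → ∀ x ∈ W, g x ∈ W := by
    intro g hg x hx
    have : W ≤ W.comap g := by
      refine Submodule.span_le.2 ?_
      rintro _ ⟨t, rfl⟩
      exact hg t t.2
    exact this hx
  have hA' : ∀ a, freeHom φ I a ∈ W := fun a =>
    linearMap_quot_mem hA (freeHom φ I : I.Quot →ₗ[k] FreePhiAlg φ I) W (fun u hu => by
      change freeHom φ I (letter I u) ∈ W
      rw [freeHom_letter]
      exact hmem _ (Or.inl ⟨u, hu, rfl⟩)) a
  have hbr : ∀ x ∈ W, freeOp φ I x ∈ W := hind _ fun t ht => by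
    rw [← wordClass_br]
    exact hmem _ (br_mem_nestWords ht)
  have hTtw : ∀ s t, T (wordClass φ I s) (wordClass φ I t) = wordClass φ I (tw σ s t) :=
    fun s t => by rw [hTa, map_tw σ (wordClass φ I) (wordClass_mul φ I)]
  have hnest : ∀ p l, (∀ q ∈ p :: l, q.1 ∈ IrrS G ∧ 1 ≤ q.2) → ∀ a,
      T (freeHom φ I a) (wordClass φ I (nest σ p l)) ∈ W := fun p l h a =>
    linearMap_quot_mem hA (T.flip (wordClass φ I (nest σ p l)) ∘ₗ
      (freeHom φ I : I.Quot →ₗ[k] FreePhiAlg φ I)) W (fun u hu => by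
        change T (freeHom φ I (letter I u)) (wordClass φ I (nest σ p l)) ∈ W
        rw [freeHom_letter, hTtw]
        exact hmem _ (Or.inr ⟨p, l, h, Or.inr ⟨u, hu, rfl⟩⟩)) a
  -- If an irreducible factor `u` already stands outside the nest, it is first merged with `a`
  -- inside `A`, and the product is expanded again into irreducible words.
  have hword : ∀ a, ∀ x ∈ W, T (freeHom φ I a) x ∈ W := fun a => hind _ fun t ht => by
    rcases ht with ⟨u, hu, rfl⟩ | ⟨p, l, h, rfl | ⟨u, hu, rfl⟩⟩
    · rw [← freeHom_letter, hTa, ← map_tw σ (freeHom φ I) (map_mul _)]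
      exact hA' _
    · exact hnest p l h a
    · rw [← hTtw, hTa, hTa, ← tw_assoc, ← freeHom_letter,
        ← map_tw σ (freeHom φ I) (map_mul _), ← hTa]
      exact hnest p l h _
  have hvar : ∀ z : Z, wordClass φ I (BWord.var z) =
      freeHom φ I (letter I (FreeSemigroup.of z)) := fun z =>
    (freeHom_letter φ I (FreeSemigroup.of z)).symm
  -- For `σ = false` the multiplication is on the right, so `x` acts before `y`.
  have hmul : ∀ x y, (∀ w ∈ W, T x w ∈ W) → (∀ w ∈ W, T y w ∈ W) → ∀ w ∈ W, T (x * y) w ∈ W := by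
    intro x y hx hy w hw
    cases σ
    · have := hy _ (hx w hw)
      rw [hTa, hTa] at this
      rw [hTa]
      change w * (x * y) ∈ W
      rw [← mul_assoc]
      exact this
    · have := hx _ (hy w hw)
      rw [hTa, hTa] at this
      rw [hTa]
      change x * y * w ∈ W
      rw [mul_assoc]
      exact this
  have hop : ∀ x, (∀ w ∈ W, T x w ∈ W) → ∀ w ∈ W, T (freeOp φ I x) w ∈ W := by
    intro x hx w hw
    rw [hTa, hP, ← hTa, ← hTa]
    exact add_mem (add_mem (hbr _ (hx w hw)) (W.smul_mem _ (hx _ (hbr w hw))))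
      (W.smul_mem _ (hx w hw))
  have hT : ∀ s, ∀ w ∈ W, T (wordClass φ I s) w ∈ W := by
    intro s
    induction s with
    | var z => rw [hvar]; exact hword _
    | br s ih => rw [wordClass_br]; exact hop _ ih
    | varCons z s ih =>
      rw [← BWord.var_mul, wordClass_mul, hvar]
      exact hmul _ _ (hword _) ih
    | brCons s s' ih ih' =>
      rw [← BWord.br_mul, wordClass_mul, wordClass_br]
      exact hmul _ _ (hop _ ih) ih'
  have hprod : ∀ s t, wordClass φ I s ∈ W → wordClass φ I t ∈ W → wordClass φ I (s * t) ∈ W := by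
    intro s t hs ht
    rw [wordClass_mul]
    cases σ
    · have := hT t _ hs
      rwa [hTa] at this
    · have := hT s _ ht
      rwa [hTa] at this
  have hall : ∀ s, wordClass φ I s ∈ W := by
    intro s
    induction s with
    | var z => rw [hvar]; exact hA' _
    | br s ih => rw [wordClass_br]; exact hbr _ ih
    | varCons z s ih => exact hprod (BWord.var z) s (by rw [hvar]; exact hA' _) ih
    | brCons s s' ih ih' => exact hprod s.br s' (by rw [wordClass_br]; exact hbr _ ih) ih'
  rw [eq_top_iff, ← span_wordClass φ I, Submodule.span_le]
  rintro _ ⟨s, rfl⟩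
  exact hall s

end Span

/-! #### Nested words are independent -/

section Independent

variable {I : AlgIdeal k (WordAlg k Z)} {G : Set (WordAlg k Z)}

/-- Adds a bracket letter to a nonempty list, and multiplies the empty list by a scalar. -/
noncomputable def bracketOp {X : Type*} (lam : k) : Module.End k (List (X ⊕ Unit) →₀ k) :=
  Finsupp.linearCombination k fun
    | [] => Finsupp.single [] lam
    | a :: l => Finsupp.single (Sum.inr () :: a :: l) 1

omit [LinearOrder Z] in
theorem bracketOp_nil {X : Type*} (lam : k) :
    bracketOp (X := X) lam (Finsupp.single [] 1) = lam • Finsupp.single [] 1 := by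
  simp [bracketOp]

theorem bracketOp_single {X : Type*} (lam : k) {l : List (X ⊕ Unit)} (hl : l ≠ []) :
    bracketOp lam (Finsupp.single l 1) = Finsupp.single (Sum.inr () :: l) 1 := by
  cases l with
  | nil => exact absurd rfl hl
  | cons a l => simp [bracketOp]

/-- The nested word given by a list of words and brackets. -/
def decodeNest (σ : Bool) (G : Set (WordAlg k Z)) : List (IrrS G ⊕ Unit) → Option (BWord Z)
  | [] => none
  | Sum.inl u :: l => some (match decodeNest σ G l with
    | none => BWord.ofWord u.1
    | some s => tw σ (BWord.ofWord u.1) s)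
  | Sum.inr _ :: l => (decodeNest σ G l).map BWord.br

variable [WellFoundedLT Z]

/-- The action of the algebra `k𝒮(Z) / I` on lists of irreducible words and brackets. -/
noncomputable def wordAct (hG : IsGSBasis G I) (Y : Type*) (σ : Bool) :
    I.Quot →ₗ[k] Module.End k (List (IrrS G ⊕ Y) →₀ k) :=
  actEnd (irrBasis hG) (twLin k I.Quot σ) Sum.inl Sum.getLeft?

theorem wordAct_mul (hG : IsGSBasis G I) (Y : Type*) (σ : Bool) (a a' : I.Quot) :
    wordAct hG Y σ (tw σ a a') = wordAct hG Y σ a * wordAct hG Y σ a' := by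
  rw [← twLin_apply (k := k)]
  exact actEnd_mul (irrBasis hG) (twLin k I.Quot σ) Sum.inl (fun _ => rfl)
    (fun x y z => by simp only [twLin_apply, tw_assoc]) a a'

theorem wordAct_single (hG : IsGSBasis G I) (Y : Type*) (σ : Bool) (u : IrrS G)
    {l : List (IrrS G ⊕ Y)} (hl : ∀ a ∈ l.head?, a.getLeft? = none) :
    wordAct hG Y σ (letter I u) (Finsupp.single l 1) = Finsupp.single (Sum.inl u :: l) 1 := by
  rw [← irrBasis_apply hG]
  exact actEnd_basis_single _ _ _ u hl

/-- The hypotheses say that `ev` turns multiplication by `f a` into the action on lists and the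
operator into the addition of a bracket letter. A nested word, built from the inside out, is thus
sent to the list of its irreducible factors and brackets. -/
theorem linearIndependent_nestWords (hG : IsGSBasis G I) (σ : Bool) (lam : k) (φ : OPI k)
    {C : Type w} [NonUnitalRing C] [Module k C] [IsScalarTower k C C] [SMulCommClass k C C]
    (Q : C →ₗ[k] C) (hQ : IsPhiAlgebra φ Q) (f : I.Quot →ₙₐ[k] C)
    (ev : C →ₗ[k] (List (IrrS G ⊕ Unit) →₀ k))
    (hev : ∀ a, ev (f a) = wordAct hG Unit σ a (Finsupp.single [] 1))
    (hev' : ∀ a c, ev (tw σ (f a) c) = wordAct hG Unit σ a (ev c))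
    (hevQ : ∀ c, ev (Q c) = bracketOp lam (ev c)) :
    LinearIndependent k fun t : nestWords σ G => wordClass φ I t := by
  obtain ⟨g, hg1, hg2⟩ := exists_freeHom_lift φ I Q hQ f
  refine linearIndependent_of_decode _ _ (ev ∘ₗ (g : FreePhiAlg φ I →ₗ[k] C)) some
    (Option.some_injective _) (decodeNest σ G) ?_
  let R : BWord Z → List (IrrS G ⊕ Unit) → Prop := fun t l =>
    ev (g (wordClass φ I t)) = Finsupp.single l 1 ∧ decodeNest σ G l = some t
  have hword : ∀ u : IrrS G, R (BWord.ofWord u) [Sum.inl u] := by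
    intro u
    refine ⟨?_, rfl⟩
    rw [← freeHom_letter, hg2, hev, wordAct_single _ _ _ _ (by simp)]
  have hbr : ∀ t l, R t l → R t.br (Sum.inr () :: l) := by
    rintro t l ⟨h1, h2⟩
    refine ⟨?_, by rw [decodeNest, h2]; rfl⟩
    -- The exceptional value of `bracketOp` at the empty list does not interfere: that list decodes
    -- to no word.
    rw [wordClass_br, hg1, hevQ, h1, bracketOp_single]
    rintro rfl
    simp [decodeNest] at h2
  have hiter : ∀ n t l, 1 ≤ n → R t l → ∃ l', R (BWord.br^[n] t) (Sum.inr () :: l') := by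
    intro n t l hn h
    induction n, hn using Nat.le_induction with
    | base => exact ⟨l, hbr _ _ h⟩
    | succ n _ ih =>
      obtain ⟨l', h'⟩ := ih
      rw [Function.iterate_succ_apply']
      exact ⟨_, hbr _ _ h'⟩
  -- The leading bracket letter keeps `u` from being multiplied into an irreducible word.
  have hjoin : ∀ (u : IrrS G) t l, R t (Sum.inr () :: l) →
      R (tw σ (BWord.ofWord u) t) (Sum.inl u :: Sum.inr () :: l) := by
    rintro u t l ⟨h1, h2⟩
    refine ⟨?_, by rw [decodeNest, h2]⟩
    rw [map_tw σ (wordClass φ I) (wordClass_mul φ I), map_tw σ g (map_mul g), ← freeHom_letter,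
      hg2, hev', h1, wordAct_single _ _ _ _ (by simp)]
  have hnest : ∀ l p, (∀ q ∈ p :: l, q.1 ∈ IrrS G ∧ 1 ≤ q.2) →
      ∃ l', R (nest σ p l) (Sum.inr () :: l') := by
    intro l
    induction l with
    | nil =>
      intro p h
      have hp := h p (by simp)
      exact hiter _ _ _ hp.2 (hword ⟨p.1, hp.1⟩)
    | cons q l ih =>
      intro p h
      have hp := h p (by simp)
      obtain ⟨l', h'⟩ := ih q fun q' hq' => h q' (by simp [List.mem_cons.1 hq'])
      exact hiter _ _ _ hp.2 (hjoin ⟨p.1, hp.1⟩ _ _ h')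
  rintro ⟨t, ⟨u, hu, rfl⟩ | ⟨p, l, h, rfl | ⟨u, hu, rfl⟩⟩⟩
  · exact ⟨_, hword ⟨u, hu⟩⟩
  · obtain ⟨l', h'⟩ := hnest l p h
    exact ⟨_, h'⟩
  · obtain ⟨l', h'⟩ := hnest l p h
    exact ⟨_, hjoin ⟨u, hu⟩ _ _ h'⟩

/-- The evaluation of endomorphisms at the empty list. -/
noncomputable def evalNil (k : Type*) [Field k] (Y : Type*) :
    Module.End k (List Y →₀ k) →ₗ[k] (List Y →₀ k) :=
  LinearMap.applyₗ (Finsupp.single [] 1)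

/-- The left action on lists as a homomorphism of algebras. -/
noncomputable def wordActHom (hG : IsGSBasis G I) (Y : Type*) :
    I.Quot →ₙₐ[k] Module.End k (List (IrrS G ⊕ Y) →₀ k) :=
  { wordAct hG Y true with
    map_zero' := map_zero (wordAct hG Y true)
    map_mul' := wordAct_mul hG Y true }

/-- The right action on lists as a homomorphism of algebras. -/
noncomputable def wordActOpHom (hG : IsGSBasis G I) (Y : Type*) :
    I.Quot →ₙₐ[k] (Module.End k (List (IrrS G ⊕ Y) →₀ k))ᵐᵒᵖ :=
  { (MulOpposite.opLinearEquiv k).toLinearMap ∘ₗ wordAct hG Y false with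
    map_zero' := map_zero ((MulOpposite.opLinearEquiv k).toLinearMap ∘ₗ wordAct hG Y false)
    map_mul' := fun a b => by
      change MulOpposite.op (wordAct hG Y false (a * b)) = MulOpposite.op _ * MulOpposite.op _
      rw [← MulOpposite.op_mul]
      exact congrArg _ (wordAct_mul hG Y false b a) }

variable (hG : IsGSBasis G I)
include hG

/-- In the model the operator is left multiplication by `bracketOp`, so `⌊x⌋y = ⌊xy⌋` is
associativity. -/
theorem isLinearBasis_opiN4 : IsLinearBasis opiN4 I (basis3 G) := by
  have hA := span_letter_irrS G I (by rw [← hG.1]; exact subset_span G)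
  rw [basis3_eq]
  constructor
  · refine linearIndependent_nestWords hG true 0 opiN4
      (LinearMap.mulLeft k (bracketOp 0 : Module.End k (List (IrrS G ⊕ Unit) →₀ k)))
      (fun r => ?_) (wordActHom hG Unit) (evalNil k _) (fun _ => rfl) (fun _ _ => rfl) fun _ => rfl
    rw [← evalHom_eq, evalHom_opiN4]
    simp [mul_assoc]
  · refine span_nestWords true 0 0 hA fun x y => ?_
    have h := isPhiAlgebra_freeOp I (isBilinearOPI_opiN4 (k := k)) ![x, y]
    rw [← evalHom_eq, evalHom_opiN4, sub_eq_zero] at h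
    simpa [tw] using h

/-- Mirror image of the previous model: right multiplication by `bracketOp` in the opposite
endomorphism algebra. -/
theorem isLinearBasis_opiN3 : IsLinearBasis opiN3 I (basis2 G) := by
  have hA := span_letter_irrS G I (by rw [← hG.1]; exact subset_span G)
  rw [basis2_eq]
  constructor
  · refine linearIndependent_nestWords hG false 0 opiN3
      (LinearMap.mulRight k (MulOpposite.op
        (bracketOp 0 : Module.End k (List (IrrS G ⊕ Unit) →₀ k))))
      (fun r => ?_) (wordActOpHom hG Unit)
      (evalNil k _ ∘ₗ (MulOpposite.opLinearEquiv k).symm.toLinearMap)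
      (fun _ => rfl) (fun _ _ => rfl) fun _ => rfl
    rw [← evalHom_eq, evalHom_opiN3]
    simp [mul_assoc]
  · refine span_nestWords false 0 0 hA fun x y => ?_
    have h := isPhiAlgebra_freeOp I (isBilinearOPI_opiN3 (k := k)) ![y, x]
    rw [← evalHom_eq, evalHom_opiN3, sub_eq_zero] at h
    simpa [tw] using h

/-- The operator is now the commutator with `bracketOp lam` in the opposite algebra, plus `lam`. For
spanning, the identity solved for `x⌊y⌋` gives the coefficients `-1` and `lam`. -/
theorem isLinearBasis_opiN1b (lam : k) : IsLinearBasis (opiN1b lam) I (basis2 G) := by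
  have hA := span_letter_irrS G I (by rw [← hG.1]; exact subset_span G)
  rw [basis2_eq]
  constructor
  · set p : (Module.End k (List (IrrS G ⊕ Unit) →₀ k))ᵐᵒᵖ := MulOpposite.op (bracketOp lam)
    refine linearIndependent_nestWords hG false lam (opiN1b lam) (commutatorOp p lam)
      (isPhiAlgebra_commutatorOp p lam) (wordActOpHom hG Unit)
      (evalNil k _ ∘ₗ (MulOpposite.opLinearEquiv k).symm.toLinearMap)
      (fun _ => rfl) (fun _ _ => rfl) fun c => ?_
    -- The empty list is an eigenvector of `bracketOp lam` with eigenvalue `lam`, chosen so that the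
    -- last two terms cancel and only the new bracket remains.
    change bracketOp lam (c.unop (Finsupp.single [] 1)) - c.unop (bracketOp lam (Finsupp.single [] 1))
      + lam • c.unop (Finsupp.single [] 1) = bracketOp lam (c.unop (Finsupp.single [] 1))
    rw [bracketOp_nil, map_smul, sub_add_cancel]
  · refine span_nestWords false (-1) lam hA fun x y => ?_
    have h := isPhiAlgebra_freeOp I (isBilinearOPI_opiN1b lam) ![y, x]
    rw [← evalHom_eq, evalHom_opiN1b] at h
    simp only [tw, cond_false]
    simp only [Matrix.cons_val_zero, Matrix.cons_val_one] at h
    rw [← sub_eq_zero, ← h]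
    module

end Independent

end Nest

/-! ### Alternating words -/

section Alternating

variable {k : Type u} [Field k] {Z : Type v} [LinearOrder Z]

/-- Products in which irreducible words alternate with brackets of elements of `V`; the flag tells
whether the first factor is a bracket. -/
inductive AltWord (G : Set (WordAlg k Z)) (V : Set (BWord Z)) : Bool → BWord Z → Prop
  | word (u) (hu : u ∈ IrrS G) : AltWord G V false (BWord.ofWord u)
  | br (v) (hv : v ∈ V) : AltWord G V true v.br
  | wordMul (u) (hu : u ∈ IrrS G) (t) (ht : AltWord G V true t) :
      AltWord G V false (BWord.ofWord u * t)
  | brMul (v) (hv : v ∈ V) (t) (ht : AltWord G V false t) : AltWord G V true (v.br * t)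

/-- The lists `[(v₁, u₁), …, (vᵣ, uᵣ)]` for which `⌊v₁⌋u₁⋯⌊vᵣ⌋uᵣ` is alternating. -/
def IsAltList (G : Set (WordAlg k Z)) (V : Set (BWord Z))
    (L : List (BWord Z × WithOne (FreeSemigroup Z))) : Prop :=
  (∀ p ∈ L, p.1 ∈ V ∧ p.2 ∈ IrrM G) ∧ L.IsChain fun p _ => p.2 ≠ 1

/-- The word `⌊v₁⌋u₁⋯⌊vᵣ⌋uᵣ`. -/
def altProd (L : List (BWord Z × WithOne (FreeSemigroup Z))) : WithOne (BWord Z) :=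
  (L.map fun p => WithOne.coe p.1.br * BWord.ofWordM p.2).prod

variable {G : Set (WordAlg k Z)} {V : Set (BWord Z)}

theorem IsAltList.exists_altWord : ∀ {L : List (BWord Z × WithOne (FreeSemigroup Z))},
    IsAltList G V L → L ≠ [] → ∃ t, altProd L = WithOne.coe t ∧ AltWord G V true t
  | [], _, h => absurd rfl h
  | [(v, a)], h, _ => by
    have hv := h.1 (v, a) (by simp)
    induction a using WithOne.recOneCoe with
    | one => exact ⟨v.br, by simp [altProd], .br v hv.1⟩
    | coe u => exact ⟨v.br * BWord.ofWord u, by simp [altProd, ofWordM_coe],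
        .brMul v hv.1 _ (.word u hv.2)⟩
  | (v, a) :: q :: L, h, _ => by
    have hv := h.1 (v, a) (by simp)
    have h2 := List.isChain_cons_cons.1 h.2
    obtain ⟨t, ht, ht'⟩ := IsAltList.exists_altWord (L := q :: L)
      ⟨fun p hp => h.1 p (List.mem_cons_of_mem _ hp), h2.2⟩ (by simp)
    obtain ⟨u, rfl⟩ := WithOne.ne_one_iff_exists.1 h2.1
    refine ⟨v.br * (BWord.ofWord u * t), ?_, .brMul v hv.1 _ (.wordMul u hv.2 _ ht')⟩
    rw [altProd, List.map_cons, List.prod_cons, ← altProd, ht, ofWordM_coe, WithOne.coe_mul,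
      WithOne.coe_mul, mul_assoc]

theorem AltWord.exists_list {b : Bool} {t : BWord Z} (h : AltWord G V b t) :
    if b then ∃ L, L ≠ [] ∧ IsAltList G V L ∧ altProd L = WithOne.coe t
    else (∃ u ∈ IrrS G, t = BWord.ofWord u) ∨ ∃ u ∈ IrrS G, ∃ L, L ≠ [] ∧ IsAltList G V L ∧
      WithOne.coe (BWord.ofWord u) * altProd L = WithOne.coe t := by
  induction h with
  | word u hu => exact Or.inl ⟨u, hu, rfl⟩
  | br v hv =>
    exact ⟨[(v, 1)], by simp, ⟨by simp [hv, one_mem_irrM], by simp⟩, by simp [altProd]⟩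
  | wordMul u hu t _ ih =>
    obtain ⟨L, h1, h2, h3⟩ := ih
    exact Or.inr ⟨u, hu, L, h1, h2, by rw [h3, WithOne.coe_mul]⟩
  | brMul v hv t _ ih =>
    rcases ih with ⟨u, hu, rfl⟩ | ⟨u, hu, L, h1, h2, h3⟩
    · exact ⟨[(v, WithOne.coe u)], by simp, ⟨by simpa using ⟨hv, hu⟩, by simp⟩,
        by simp [altProd, ofWordM_coe]⟩
    · refine ⟨(v, WithOne.coe u) :: L, by simp, ⟨?_, ?_⟩, ?_⟩
      · intro p hp
        rcases List.mem_cons.1 hp with rfl | hp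
        · exact ⟨hv, hu⟩
        · exact h2.1 p hp
      · cases L with
        | nil => simp
        | cons q L => exact List.isChain_cons_cons.2 ⟨WithOne.coe_ne_one, h2.2⟩
      · rw [altProd, List.map_cons, List.prod_cons, ← altProd, ofWordM_coe, mul_assoc, h3,
          WithOne.coe_mul]

theorem mem_alternatingWords_of_list {a₀ : WithOne (FreeSemigroup Z)} (ha₀ : a₀ ∈ IrrM G)
    {L : List (BWord Z × WithOne (FreeSemigroup Z))} (hL : L ≠ []) (h : IsAltList G V L)
    {t : BWord Z} (ht : BWord.ofWordM a₀ * altProd L = WithOne.coe t) :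
    t ∈ alternatingWords G V := by
  have hpos := List.length_pos_iff.2 hL
  refine ⟨L.length, hpos, Fin.cons a₀ fun j => L[j].2, fun j => L[j].1, ha₀, ?_, ?_, ?_, ?_⟩
  · have : Fin.last L.length = Fin.succ ⟨L.length - 1, by omega⟩ := by
      ext; simp; omega
    rw [this, Fin.cons_succ]
    exact (h.1 _ (List.getElem_mem _)).2
  · intro i hi hi'
    obtain ⟨j, rfl⟩ := Fin.exists_succ_eq.2 hi
    rw [Fin.cons_succ]
    have hj : j.1 + 1 < L.length := by
      have h1 := j.2
      have h2 : j.1 + 1 ≠ L.length := fun h => hi' (by ext; simpa using h)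
      omega
    have h1 := List.isChain_iff_getElem.1 h.2 j.1 hj
    obtain ⟨u, hu⟩ := WithOne.ne_one_iff_exists.1 h1
    refine ⟨u, ?_, hu.symm⟩
    rw [← coe_mem_irrM, hu]
    exact (h.1 _ (List.getElem_mem _)).2
  · exact fun j => (h.1 _ (List.getElem_mem _)).1
  · rw [← ht]
    simp only [Fin.cons_zero, Fin.cons_succ, altProd]
    congr 2
    exact List.ext_getElem (by simp) (by simp)

/-- Replaces the description by indexed families by the inductive one, whose flag records the type
of the first factor and so excludes adjacent brackets and adjacent irreducible words. -/
theorem mem_union_alternatingWords_iff {t : BWord Z} :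
    t ∈ BWord.ofWord '' IrrS G ∪ alternatingWords G V ↔ ∃ b, AltWord G V b t := by
  constructor
  · rintro (⟨u, hu, rfl⟩ | ⟨r, hr, a, b, h0, hl, hm, hb, ht⟩)
    · exact ⟨false, .word u hu⟩
    · set L : List (BWord Z × WithOne (FreeSemigroup Z)) :=
        List.ofFn fun j : Fin r => (b j, a j.succ) with hL
      have hL0 : L ≠ [] := by
        intro h
        have := congrArg List.length h
        simp [hL] at this
        omega
      have hmid : ∀ i, i ≠ 0 → a i ∈ IrrM G := by
        intro i hi
        by_cases hi' : i = Fin.last r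
        · rw [hi']; exact hl
        · obtain ⟨s, hs, h⟩ := hm i hi hi'
          rw [h]; exact hs
      have hLalt : IsAltList G V L := by
        constructor
        · intro p hp
          obtain ⟨j, rfl⟩ := (List.mem_ofFn' _ _).1 hp
          exact ⟨hb j, hmid _ (Fin.succ_ne_zero j)⟩
        · rw [hL, List.isChain_ofFn]
          intro i hi
          obtain ⟨s, -, h⟩ := hm (Fin.succ ⟨i, by omega⟩) (Fin.succ_ne_zero _) (by
            intro h
            have := congrArg Fin.val h
            simp at this
            omega)
          change a (Fin.succ ⟨i, _⟩) ≠ 1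
          rw [h]
          exact WithOne.coe_ne_one
      obtain ⟨s, hs, hs'⟩ := hLalt.exists_altWord hL0
      have hprod : altProd L = (List.ofFn fun j : Fin r =>
          WithOne.coe (b j).br * BWord.ofWordM (a j.succ)).prod := by
        rw [altProd, hL, List.map_ofFn]; rfl
      rw [← hprod, hs] at ht
      generalize a 0 = a₀ at h0 ht
      induction a₀ using WithOne.recOneCoe with
      | one =>
        rw [map_one, one_mul, WithOne.coe_inj] at ht
        exact ⟨true, ht ▸ hs'⟩
      | coe u =>
        rw [ofWordM_coe, ← WithOne.coe_mul, WithOne.coe_inj] at ht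
        exact ⟨false, ht ▸ .wordMul u h0 _ hs'⟩
  · rintro ⟨_ | _, h⟩
    · rcases h.exists_list with ⟨u, hu, rfl⟩ | ⟨u, hu, L, h1, h2, h3⟩
      · exact Or.inl ⟨u, hu, rfl⟩
      · exact Or.inr (mem_alternatingWords_of_list (coe_mem_irrM.2 hu) h1 h2 h3)
    · obtain ⟨L, h1, h2, h3⟩ := h.exists_list
      exact Or.inr (mem_alternatingWords_of_list (one_mem_irrM G) h1 h2 (by simpa using h3))

theorem AltWord.mono {V' : Set (BWord Z)} (hV : V ⊆ V') {b : Bool} {t : BWord Z}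
    (h : AltWord G V b t) : AltWord G V' b t := by
  induction h with
  | word u hu => exact .word u hu
  | br v hv => exact .br v (hV hv)
  | wordMul u hu t _ ih => exact .wordMul u hu t ih
  | brMul v hv t _ ih => exact .brMul v (hV hv) t ih

theorem mem_basisStep_succ {n : ℕ} {t : BWord Z} :
    t ∈ basisStep G (n + 1) ↔ ∃ b, AltWord G (basisStep G n) b t :=
  mem_union_alternatingWords_iff

theorem basisStep_mono : Monotone (basisStep G) := by
  refine monotone_nat_of_le_succ fun n => ?_
  induction n with
  | zero => exact Set.subset_union_left
  | succ n ih =>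
    intro t ht
    obtain ⟨b, h⟩ := mem_basisStep_succ.1 ht
    exact mem_basisStep_succ.2 ⟨b, h.mono ih⟩

/-- The increasing union is a fixed point of the construction, because a word has finitely many
bracket factors and their contents all lie in one `basisStep`. -/
theorem mem_basis1_iff {t : BWord Z} : t ∈ basis1 G ↔ ∃ b, AltWord G (basis1 G) b t := by
  constructor
  · intro h
    obtain ⟨n, h⟩ := Set.mem_iUnion.1 h
    obtain ⟨b, h⟩ := mem_basisStep_succ.1 (basisStep_mono (Nat.le_succ n) h)
    exact ⟨b, h.mono (Set.subset_iUnion _ n)⟩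
  · rintro ⟨b, h⟩
    suffices h' : ∃ n, AltWord G (basisStep G n) b t by
      obtain ⟨n, h'⟩ := h'
      exact Set.mem_iUnion.2 ⟨n + 1, mem_basisStep_succ.2 ⟨b, h'⟩⟩
    induction h with
    | word u hu => exact ⟨0, .word u hu⟩
    | br v hv =>
      obtain ⟨n, hn⟩ := Set.mem_iUnion.1 hv
      exact ⟨n, .br v hn⟩
    | wordMul u hu t _ ih =>
      obtain ⟨n, hn⟩ := ih
      exact ⟨n, .wordMul u hu t hn⟩
    | brMul v hv t _ ih =>
      obtain ⟨n, hn⟩ := ih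
      obtain ⟨m, hm⟩ := Set.mem_iUnion.1 hv
      exact ⟨max m n, .brMul v (basisStep_mono (le_max_left m n) hm) t
        (hn.mono (basisStep_mono (le_max_right m n)))⟩

end Alternating

/-! ### Independence of the alternating words -/

section FreeProduct

/-- A linearly independent family is part of a basis. -/
theorem exists_basis_extending {K V ι : Type*} [Field K] [AddCommGroup V] [Module K V] {v : ι → V}
    (hs : LinearIndependent K v) : ∃ (Y : Set V) (b : Module.Basis Y K V) (i : ι → Y),
      Function.Injective i ∧ ∀ j, b (i j) = v j := by
  refine ⟨_, Module.Basis.extend hs.linearIndepOn_id,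
    fun j => ⟨v j, Module.Basis.subset_extend hs.linearIndepOn_id ⟨j, rfl⟩⟩, fun i j h => ?_,
    fun j => Module.Basis.extend_apply_self _ _⟩
  exact hs.injective (congrArg Subtype.val h)

/-- The product of the words given by the letters of a list. -/
def decodeMul {Λ W : Type*} [Mul W] (h : Λ → Option W) : List Λ → Option W
  | [] => none
  | a :: l => (h a).map fun s => match decodeMul h l with
    | none => s
    | some t => s * t

variable {k : Type u} [Field k] {Z : Type v} {I : AlgIdeal k (WordAlg k Z)}

/-- Words evaluated with the letters `Z` mapped to an algebra over `k𝒮(Z) / I`. -/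
noncomputable def evalIn {C : Type*} [Mul C] (Q : C → C) (f : I.Quot → C) (t : BWord Z) : C :=
  t.eval Q fun z => f (letter I (FreeSemigroup.of z))

theorem evalIn_mul {C : Type*} [Semigroup C] (Q : C → C) (f : I.Quot → C) (s t : BWord Z) :
    evalIn Q f (s * t) = evalIn Q f s * evalIn Q f t := BWord.eval_mul _ _ _ _

theorem evalIn_br {C : Type*} [Mul C] (Q : C → C) (f : I.Quot → C) (s : BWord Z) :
    evalIn Q f s.br = Q (evalIn Q f s) := rfl

theorem evalIn_ofWord {C : Type*} [NonUnitalRing C] [Module k C] (Q : C → C) (f : I.Quot →ₙₐ[k] C) (u : FreeSemigroup Z) :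
    evalIn Q f (BWord.ofWord u) = f (letter I u) :=
  eval_ofWord_letter I f (map_mul f) Q u

variable [LinearOrder Z] [WellFoundedLT Z] {G : Set (WordAlg k Z)}

/-- The independent values of `V` are completed to a basis `Y` of `C`. On lists in irreducible words
and elements of `Y`, both `A` and `C` act, each multiplying only into its own letters. The new
algebra pairs such endomorphisms with `C`, the second component keeping the old values of bracket
contents available to the new operator. -/
theorem exists_model_succ (hG : IsGSBasis G I) (c : k) (σ : Bool) (V : Set (BWord Z))
    {C : Type (max u v)} [NonUnitalRing C] [Module k C] [IsScalarTower k C C] [SMulCommClass k C C]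
    (Q : C →ₗ[k] C) (f : I.Quot →ₙₐ[k] C) (hQ : ∀ x y, Q x * Q y = c • Q (tw σ x y))
    (hind : LinearIndependent k fun t : V => evalIn Q f (t : BWord Z)) :
    ∃ (D : Type (max u v)) (_ : NonUnitalRing D) (_ : Module k D) (_ : IsScalarTower k D D)
      (_ : SMulCommClass k D D) (Q' : D →ₗ[k] D) (f' : I.Quot →ₙₐ[k] D),
      (∀ x y, Q' x * Q' y = c • Q' (tw σ x y)) ∧
      LinearIndependent k fun t : {t | ∃ b, AltWord G V b t} => evalIn Q' f' (t : BWord Z) := by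
  obtain ⟨Y, bC, i, hi, hbC⟩ := exists_basis_extending hind
  -- The scaled, possibly reversed product is still associative; that `actC` is multiplicative for
  -- it is exactly the identity required of the new operator.
  let m : C →ₗ[k] C →ₗ[k] C := c • twLin k C σ
  have hm : ∀ x y, m x y = c • tw σ x y := fun x y => congrArg (c • ·) (twLin_apply σ x y)
  let actC : C →ₗ[k] Module.End k (List (IrrS G ⊕ Y) →₀ k) :=
    actEnd bC m Sum.inr Sum.getRight?
  have hactC : ∀ x y, c • actC (tw σ x y) = actC x * actC y := by
    intro x y
    rw [← map_smul, ← hm]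
    refine actEnd_mul bC m Sum.inr (fun _ => rfl) (fun x y z => ?_) x y
    rw [hm, hm, hm, hm, tw_smul_left, tw_smul_right, tw_assoc]
  have hactC' : ∀ (v : V) l, (∀ a ∈ l.head?, a.isRight = false) →
      actC (evalIn Q f (v : BWord Z)) (Finsupp.single l 1) =
        Finsupp.single (Sum.inr (i v) :: l) 1 := by
    intro v l hl
    rw [← hbC]
    refine actEnd_basis_single _ _ _ _ fun a ha => ?_
    have := hl a ha
    cases a <;> simp_all
  let Q' : Module.End k (List (IrrS G ⊕ Y) →₀ k) × C →ₗ[k]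
      Module.End k (List (IrrS G ⊕ Y) →₀ k) × C := (actC.prod Q) ∘ₗ LinearMap.snd k _ _
  let f' : I.Quot →ₙₐ[k] Module.End k (List (IrrS G ⊕ Y) →₀ k) × C :=
    NonUnitalAlgHom.prod (wordActHom hG Y) f
  refine ⟨Module.End k (List (IrrS G ⊕ Y) →₀ k) × C, inferInstance, inferInstance, inferInstance,
    inferInstance, Q', f', ?_, ?_⟩
  · intro x y
    have h : (tw σ x y).2 = tw σ x.2 y.2 := map_tw σ Prod.snd (fun _ _ => rfl) x y
    refine Prod.ext ?_ ?_
    · change actC x.2 * actC y.2 = c • actC (tw σ x y).2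
      rw [h, hactC]
    · change Q x.2 * Q y.2 = c • Q (tw σ x y).2
      rw [h, hQ]
  have hsnd : ∀ t : BWord Z, (evalIn Q' f' t).2 = evalIn Q f t := fun t =>
    BWord.map_eval Q' Q _ Prod.snd (fun _ _ => rfl) (fun _ => rfl) t
  have hmul : ∀ s t : BWord Z, evalIn Q' f' (s * t) = evalIn Q' f' s * evalIn Q' f' t :=
    BWord.eval_mul _ _
  have hword : ∀ u, evalIn Q' f' (BWord.ofWord u) = f' (letter I u) :=
    eval_ofWord_letter I f' (map_mul f') Q'
  -- `Y` also contains basis vectors that come from no word of `V`; these decode to `none`.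
  let dl : IrrS G ⊕ Y → Option (BWord Z) :=
    Sum.elim (fun u => some (BWord.ofWord u.1))
      (fun y => (Function.partialInv i y).map fun v => BWord.br v.1)
  have hdl : ∀ v : V, dl (Sum.inr (i v)) = some (BWord.br v) := by
    intro v
    simp [dl, Function.partialInv_left hi]
  refine linearIndependent_of_decode _ _ (evalNil k (IrrS G ⊕ Y) ∘ₗ LinearMap.fst k _ _) some
    (Option.some_injective _) (decodeMul dl) ?_
  rintro ⟨t, b, ht⟩
  -- The claim also tracks the type of the first letter: since it agrees with the flag, the next
  -- factor is of the other type and is prepended, not multiplied in.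
  suffices h : ∃ l, (evalIn Q' f' t).1 (Finsupp.single [] 1) = Finsupp.single l 1 ∧
      decodeMul dl l = some t ∧ ∀ a ∈ l.head?, a.isRight = b by
    obtain ⟨l, h1, h2, -⟩ := h
    exact ⟨l, h1, h2⟩
  induction ht with
  | word u hu =>
    refine ⟨[Sum.inl ⟨u, hu⟩], ?_, rfl, by simp⟩
    rw [hword]
    exact wordAct_single hG Y true ⟨u, hu⟩ (by simp)
  | br v hv =>
    refine ⟨[Sum.inr (i ⟨v, hv⟩)], ?_, ?_, by simp⟩
    · change actC (evalIn Q' f' v).2 _ = _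
      rw [hsnd]
      exact hactC' ⟨v, hv⟩ _ (by simp)
    · rw [decodeMul, hdl]; rfl
  | wordMul u hu t _ ih =>
    obtain ⟨l, h1, h2, h3⟩ := ih
    refine ⟨Sum.inl ⟨u, hu⟩ :: l, ?_, ?_, by simp⟩
    · rw [hmul, hword, Prod.fst_mul, Module.End.mul_apply, h1]
      refine wordAct_single hG Y true ⟨u, hu⟩ fun a ha => ?_
      have := h3 a ha
      cases a <;> simp_all
    · rw [decodeMul, h2]; rfl
  | brMul v hv t _ ih =>
    obtain ⟨l, h1, h2, h3⟩ := ih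
    refine ⟨Sum.inr (i ⟨v, hv⟩) :: l, ?_, ?_, by simp⟩
    · rw [hmul, Prod.fst_mul, Module.End.mul_apply, h1]
      change actC (evalIn Q' f' v).2 _ = _
      rw [hsnd]
      exact hactC' ⟨v, hv⟩ _ h3
    · rw [decodeMul, h2, hdl]; rfl

/-- At depth zero no brackets occur, so `A` itself with the zero operator is a model. -/
theorem exists_model (hG : IsGSBasis G I) (c : k) (σ : Bool) (n : ℕ) :
    ∃ (D : Type (max u v)) (_ : NonUnitalRing D) (_ : Module k D) (_ : IsScalarTower k D D)
      (_ : SMulCommClass k D D) (Q : D →ₗ[k] D) (f : I.Quot →ₙₐ[k] D),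
      (∀ x y, Q x * Q y = c • Q (tw σ x y)) ∧
      LinearIndependent k fun t : basisStep G n => evalIn Q f (t : BWord Z) := by
  induction n with
  | zero =>
    refine ⟨I.Quot, inferInstance, inferInstance, inferInstance, inferInstance, 0,
      NonUnitalAlgHom.id k I.Quot, fun x y => by simp, ?_⟩
    have h : ∀ t : basisStep G 0, ∃ u : IrrS G, BWord.ofWord u.1 = t := by
      rintro ⟨_, u, hu, rfl⟩
      exact ⟨⟨u, hu⟩, rfl⟩
    choose u hu using h
    have := (linearIndependent_letter_irrS hG).comp u fun s t hst =>
      Subtype.ext (by rw [← hu s, ← hu t, hst])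
    convert this using 1
    funext t
    change evalIn _ _ t.1 = letter I (u t)
    rw [← hu t]
    exact eval_ofWord_letter I (NonUnitalAlgHom.id k I.Quot) (fun _ _ => rfl) _ _
  | succ n ih =>
    obtain ⟨C, _, _, _, _, Q, f, hQ, hind⟩ := ih
    have h : basisStep G (n + 1) = {t | ∃ b, AltWord G (basisStep G n) b t} :=
      Set.ext fun t => mem_basisStep_succ
    rw [h]
    exact exists_model_succ hG c σ _ Q f hQ hind

end FreeProduct

/-! ### Alternating words span -/

/-- The number of brackets of a word. -/
def BWord.brCount {Z : Type*} : BWord Z → ℕ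
  | var _ => 0
  | br s => s.brCount + 1
  | varCons _ s => s.brCount
  | brCons s s' => s.brCount + 1 + s'.brCount

theorem BWord.brCount_mul {Z : Type*} (s t : BWord Z) :
    (s * t).brCount = s.brCount + t.brCount := by
  induction s with
  | var z => rw [var_mul, brCount, brCount, zero_add]
  | br s _ => rw [br_mul, brCount, brCount]
  | varCons z s ih => rw [varCons_mul, brCount, ih, brCount]
  | brCons s s' _ ih => rw [brCons_mul, brCount, ih, brCount]; omega

theorem BWord.brCount_ofWord {Z : Type*} (u : FreeSemigroup Z) : (ofWord u).brCount = 0 := by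
  induction u using FreeSemigroup.recOnMul with
  | ih1 z => rfl
  | ih2 z u h1 h2 => rw [map_mul, brCount_mul, h1, h2]

section Bilin

variable {k : Type*} [Field k] {M N P : Type*} [AddCommGroup M] [Module k M] [AddCommGroup N]
  [Module k N] [AddCommGroup P] [Module k P]

theorem linear_mem_of_span (T : M →ₗ[k] P) {X : Set M} {W : Submodule k P}
    (h : ∀ x ∈ X, T x ∈ W) {x : M} (hx : x ∈ Submodule.span k X) : T x ∈ W :=
  (Submodule.span_le (p := W.comap T)).2 h hx

theorem bilinear_mem_of_span (T : M →ₗ[k] N →ₗ[k] P) {X : Set M} {Y : Set N} {W : Submodule k P}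
    (h : ∀ x ∈ X, ∀ y ∈ Y, T x y ∈ W) {x : M} {y : N} (hx : x ∈ Submodule.span k X)
    (hy : y ∈ Submodule.span k Y) : T x y ∈ W :=
  linear_mem_of_span (T.flip y) (fun x hx => linear_mem_of_span (T x) (h x hx) hy) hx

end Bilin

section Span

variable {k : Type u} [Field k] {Z : Type v} [LinearOrder Z] {G : Set (WordAlg k Z)}
  {I : AlgIdeal k (WordAlg k Z)} {C : Type w} [NonUnitalRing C] [Module k C]

/-- The span of the values of the alternating words with at most `m` brackets. -/
noncomputable def altSpan (G : Set (WordAlg k Z)) (Q : C → C) (f : I.Quot → C) (m : ℕ) :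
    Submodule k C :=
  Submodule.span k (evalIn Q f '' {t | t ∈ basis1 G ∧ t.brCount ≤ m})

theorem altSpan_mono (Q : C → C) (f : I.Quot → C) : Monotone (altSpan G Q f) := fun _ _ h =>
  Submodule.span_mono (Set.image_mono fun _ ht => ⟨ht.1, ht.2.trans h⟩)

theorem evalIn_mem_altSpan (Q : C → C) (f : I.Quot → C) {t : BWord Z} (ht : t ∈ basis1 G) {m : ℕ}
    (hm : t.brCount ≤ m) : evalIn Q f t ∈ altSpan G Q f m :=
  Submodule.subset_span ⟨t, ⟨ht, hm⟩, rfl⟩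

variable (hA : Submodule.span k (Set.range fun u : IrrS G => letter I u) = ⊤)
  {Q : C →ₗ[k] C} {f : I.Quot →ₙₐ[k] C}

theorem AltWord.mem_basis1 {b : Bool} {t : BWord Z} (h : AltWord G (basis1 G) b t) :
    t ∈ basis1 G := mem_basis1_iff.2 ⟨b, h⟩

theorem operator_mem_altSpan {m : ℕ} {x : C} (hx : x ∈ altSpan G Q f m) :
    Q x ∈ altSpan G Q f (m + 1) := by
  refine linear_mem_of_span Q ?_ hx
  rintro _ ⟨t, ht, rfl⟩
  rw [← evalIn_br Q]
  exact evalIn_mem_altSpan _ _ (AltWord.br t ht.1).mem_basis1 (Nat.succ_le_succ ht.2)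

include hA

theorem algebra_mem_altSpan (a : I.Quot) (m : ℕ) : f a ∈ altSpan G Q f m :=
  linearMap_quot_mem hA (f : I.Quot →ₗ[k] C) _ (fun u hu => by
    change f (letter I u) ∈ _
    rw [← evalIn_ofWord Q]
    exact evalIn_mem_altSpan _ _ (AltWord.word u hu).mem_basis1
      (by rw [BWord.brCount_ofWord]; exact Nat.zero_le _)) a

variable [IsScalarTower k C C] [SMulCommClass k C C]

/-- If the word starts with a bracket, `a` is expanded into irreducible words placed in front of it;
if it starts with an irreducible word, that word is absorbed into `a` first. -/
theorem algebra_mul_mem_altSpan (a : I.Quot) {m : ℕ} {x : C} (hx : x ∈ altSpan G Q f m) :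
    f a * x ∈ altSpan G Q f m := by
  have key : ∀ t, AltWord G (basis1 G) true t → t.brCount ≤ m → ∀ a,
      f a * evalIn Q f t ∈ altSpan G Q f m := fun t ht hm a =>
    linearMap_quot_mem hA (LinearMap.mulRight k (evalIn Q f t) ∘ₗ (f : I.Quot →ₗ[k] C)) _
      (fun u hu => by
        change f (letter I u) * evalIn Q f t ∈ _
        rw [← evalIn_ofWord Q, ← evalIn_mul]
        exact evalIn_mem_altSpan _ _ (AltWord.wordMul u hu t ht).mem_basis1
          (by rwa [BWord.brCount_mul, BWord.brCount_ofWord, zero_add])) a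
  refine linear_mem_of_span (LinearMap.mulLeft k (f a)) ?_ hx
  rintro _ ⟨t, ⟨ht, hm⟩, rfl⟩
  change f a * evalIn Q f t ∈ _
  obtain ⟨b, ht'⟩ := mem_basis1_iff.1 ht
  cases ht' with
  | word u hu =>
    rw [evalIn_ofWord, ← map_mul]
    exact algebra_mem_altSpan hA _ _
  | br v hv => exact key _ (.br v hv) hm a
  | wordMul u hu r hr =>
    rw [BWord.brCount_mul, BWord.brCount_ofWord, zero_add] at hm
    rw [evalIn_mul, evalIn_ofWord, ← mul_assoc, ← map_mul]
    exact key r hr hm _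
  | brMul v hv r hr => exact key _ (.brMul v hv r hr) hm a

variable {c : k} {σ : Bool} (hQ : ∀ x y, Q x * Q y = c • Q (tw σ x y))
include hQ

/-- The only obstruction to concatenation, beyond multiplication in `A`, is a bracket meeting a
bracket. There `hQ` replaces two brackets by one around a product of their contents, and that
product has fewer brackets than `N`, so the strong induction applies. -/
theorem mul_mem_altSpan_of_le (N : ℕ) : ∀ s ∈ basis1 G, ∀ t ∈ basis1 G,
    s.brCount + t.brCount ≤ N → evalIn Q f s * evalIn Q f t ∈ altSpan G Q f N := by
  induction N using Nat.strong_induction_on with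
  | _ N IH =>
  have htw : ∀ v ∈ basis1 G, ∀ v' ∈ basis1 G, v.brCount + v'.brCount < N →
      tw σ (evalIn Q f v) (evalIn Q f v') ∈ altSpan G Q f (v.brCount + v'.brCount) := by
    intro v hv v' hv' h
    cases σ
    · exact IH _ h v' hv' v hv (by rw [add_comm])
    · exact IH _ h v hv v' hv' le_rfl
  have hrest : ∀ r, AltWord G (basis1 G) false r → ∀ m, ∀ y ∈ altSpan G Q f m,
      Q y * evalIn Q f r ∈ altSpan G Q f (m + 1 + r.brCount) := by
    intro r hr m y hy
    refine linear_mem_of_span (LinearMap.mulRight k (evalIn Q f r) ∘ₗ Q) ?_ hy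
    rintro _ ⟨v, ⟨hv, hm⟩, rfl⟩
    change Q (evalIn Q f v) * evalIn Q f r ∈ _
    rw [← evalIn_br Q, ← evalIn_mul]
    refine evalIn_mem_altSpan _ _ (AltWord.brMul v hv r hr).mem_basis1 ?_
    rw [BWord.brCount_mul, BWord.brCount]
    omega
  have hbracket : ∀ v ∈ basis1 G, ∀ t ∈ basis1 G, v.brCount + 1 + t.brCount ≤ N →
      Q (evalIn Q f v) * evalIn Q f t ∈ altSpan G Q f N := by
    intro v hv t ht hN
    obtain ⟨b, ht⟩ := mem_basis1_iff.1 ht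
    have hfalse : ∀ t, AltWord G (basis1 G) false t → v.brCount + 1 + t.brCount ≤ N →
        Q (evalIn Q f v) * evalIn Q f t ∈ altSpan G Q f N := fun t ht h =>
      altSpan_mono _ _ h (hrest t ht _ _ (evalIn_mem_altSpan _ _ hv le_rfl))
    cases ht with
    | word u hu => exact hfalse _ (.word u hu) hN
    | wordMul u hu r hr => exact hfalse _ (.wordMul u hu r hr) hN
    | br v' hv' =>
      rw [BWord.brCount] at hN
      rw [evalIn_br, hQ]
      exact Submodule.smul_mem _ _ (altSpan_mono _ _ (by omega)
        (operator_mem_altSpan (htw v hv v' hv' (by omega))))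
    | brMul v' hv' r hr =>
      rw [BWord.brCount_mul, BWord.brCount] at hN
      rw [evalIn_mul, evalIn_br, ← mul_assoc, hQ, smul_mul_assoc]
      exact Submodule.smul_mem _ _ (altSpan_mono _ _ (by omega)
        (hrest r hr _ _ (htw v hv v' hv' (by omega))))
  intro s hs t ht hN
  obtain ⟨b, hs⟩ := mem_basis1_iff.1 hs
  clear * - hs ht hN hbracket IH hA
  induction hs with
  | word u hu =>
    rw [evalIn_ofWord]
    rw [BWord.brCount_ofWord, zero_add] at hN
    exact algebra_mul_mem_altSpan hA _ (evalIn_mem_altSpan _ _ ht hN)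
  | br v hv => exact hbracket v hv t ht hN
  | wordMul u hu r hr ih =>
    rw [BWord.brCount_mul, BWord.brCount_ofWord, zero_add] at hN
    rw [evalIn_mul, mul_assoc, evalIn_ofWord]
    exact algebra_mul_mem_altSpan hA _ (ih hN)
  | brMul v hv r hr _ =>
    rw [BWord.brCount_mul, BWord.brCount] at hN
    rw [evalIn_mul, mul_assoc, evalIn_br]
    -- The tail `r t` has lost the bracket of `v`; it is expanded first, and `hbracket` then
    -- multiplies `⌊v⌋` into each resulting word.
    have h := IH (r.brCount + t.brCount) (by omega) r hr.mem_basis1 t ht le_rfl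
    refine linear_mem_of_span (LinearMap.mulLeft k (Q (evalIn Q f v))) ?_ h
    rintro _ ⟨t', ⟨ht', hm⟩, rfl⟩
    exact hbracket v hv t' ht' (by omega)

theorem mul_mem_altSpan {m n : ℕ} {x y : C} (hx : x ∈ altSpan G Q f m)
    (hy : y ∈ altSpan G Q f n) : x * y ∈ altSpan G Q f (m + n) := by
  refine bilinear_mem_of_span (LinearMap.mul k C) ?_ hx hy
  rintro _ ⟨s, ⟨hs, hsm⟩, rfl⟩ _ ⟨t, ⟨ht, htn⟩, rfl⟩
  exact mul_mem_altSpan_of_le hA hQ (m + n) s hs t ht (by omega)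

/-- The value of a word is a combination of values of alternating words with at most as many
brackets. -/
theorem evalIn_mem_altSpan_brCount (t : BWord Z) :
    evalIn Q f t ∈ altSpan G Q f t.brCount := by
  have hvar : ∀ z : Z, evalIn Q f (BWord.var z) ∈ altSpan G Q f (BWord.var z).brCount := fun z =>
    algebra_mem_altSpan hA (letter I (FreeSemigroup.of z)) _
  have hmul : ∀ s t : BWord Z, evalIn Q f s ∈ altSpan G Q f s.brCount →
      evalIn Q f t ∈ altSpan G Q f t.brCount → evalIn Q f (s * t) ∈ altSpan G Q f (s * t).brCount := by
    intro s t hs ht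
    rw [evalIn_mul, BWord.brCount_mul]
    exact mul_mem_altSpan hA hQ hs ht
  induction t with
  | var z => exact hvar z
  | br s ih => exact operator_mem_altSpan ih
  | varCons z s ih => exact hmul (BWord.var z) s (hvar z) ih
  | brCons s s' ih ih' => exact hmul s.br s' (operator_mem_altSpan ih) ih'

end Span

/-! ### Change of the operator by a scalar -/

section Triangular

/-- A family which differs from a linearly independent family by terms of lower degree is linearly
independent. -/
theorem linearIndependent_of_triangular {k V ι : Type*} [Field k] [AddCommGroup V] [Module k V]
    {p q : ι → V} {d : ι → ℕ} (hq : LinearIndependent k q)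
    (h : ∀ i, p i - q i ∈ Submodule.span k (q '' {j | d j < d i})) : LinearIndependent k p := by
  rw [linearIndependent_iff]
  intro l hl
  by_contra h0
  obtain ⟨i, hi, hmax⟩ := l.support.exists_max_image d (Finsupp.support_nonempty_iff.2 h0)
  have h1 : Finsupp.linearCombination k q l ∈ Submodule.span k (q '' {j | d j < d i}) := by
    have h2 : Finsupp.linearCombination k q l = -∑ j ∈ l.support, l j • (p j - q j) := by
      rw [Finsupp.linearCombination_apply, Finsupp.sum] at hl ⊢
      simp only [smul_sub, Finset.sum_sub_distrib, hl, zero_sub, neg_neg]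
    rw [h2]
    refine Submodule.neg_mem _ (Submodule.sum_mem _ fun j hj => Submodule.smul_mem _ _ ?_)
    exact Submodule.span_mono (Set.image_mono fun j' hj' => lt_of_lt_of_le hj' (hmax j hj)) (h j)
  obtain ⟨l', hl', h2⟩ := (Finsupp.mem_span_image_iff_linearCombination k).1 h1
  rw [hq h2] at hl'
  exact lt_irrefl (d i) (hl' hi)

/-- A family which differs from a given family by terms of lower degree spans at least as much. -/
theorem range_subset_span_of_triangular {k V ι : Type*} [Field k] [AddCommGroup V] [Module k V]
    {p q : ι → V} {d : ι → ℕ}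
    (h : ∀ i, p i - q i ∈ Submodule.span k (q '' {j | d j < d i})) :
    Submodule.span k (Set.range q) ≤ Submodule.span k (Set.range p) := by
  have key : ∀ n, ∀ i, d i = n → q i ∈ Submodule.span k (Set.range p) := by
    intro n
    induction n using Nat.strong_induction_on with
    | _ n ih =>
    rintro i rfl
    have h1 : Submodule.span k (q '' {j | d j < d i}) ≤ Submodule.span k (Set.range p) := by
      refine Submodule.span_le.2 ?_
      rintro _ ⟨j, hj, rfl⟩
      exact ih _ hj j rfl
    have := sub_mem (Submodule.subset_span (Set.mem_range_self i)) (h1 (h i))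
    rwa [sub_sub_cancel] at this
  refine Submodule.span_le.2 ?_
  rintro _ ⟨i, rfl⟩
  exact key _ i rfl

variable {k : Type u} [Field k] {Z : Type v} {I : AlgIdeal k (WordAlg k Z)} {C : Type w}
  [NonUnitalRing C] [Module k C] [IsScalarTower k C C] [SMulCommClass k C C]

/-- The span of the values of the words with less than `m` brackets. -/
noncomputable def evalSpan (Q : C → C) (f : I.Quot → C) (m : ℕ) : Submodule k C :=
  Submodule.span k (evalIn Q f '' {t | t.brCount < m})

omit [IsScalarTower k C C] [SMulCommClass k C C] in
theorem evalSpan_mono (Q : C → C) (f : I.Quot → C) : Monotone (evalSpan Q f) := fun _ _ h =>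
  Submodule.span_mono (Set.image_mono fun _ ht => lt_of_lt_of_le ht h)

/-- `evalSpan` bounds bracket counts strictly, so factors have at most `m - 1` and `n - 1` brackets;
hence the slack of one in `hl`. -/
theorem mul_mem_evalSpan {Q : C → C} {f : I.Quot → C} {m n l : ℕ} {x y : C}
    (hx : x ∈ evalSpan Q f m) (hy : y ∈ evalSpan Q f n) (hl : m + n ≤ l + 1) :
    x * y ∈ evalSpan Q f l := by
  refine bilinear_mem_of_span (LinearMap.mul k C) ?_ hx hy
  rintro _ ⟨s, hs, rfl⟩ _ ⟨t, ht, rfl⟩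
  refine Submodule.subset_span ⟨s * t, ?_, evalIn_mul _ _ _ _⟩
  simp only [Set.mem_ofPred_eq, BWord.brCount_mul] at hs ht ⊢
  omega

/-- Expanding each bracket as `Q + lam`, the term with `Q` everywhere is the word evaluated with
`Q`, and every other term has lost a bracket. -/
theorem evalIn_sub_mem_evalSpan {P Q : C →ₗ[k] C} {lam : k} (hPQ : ∀ x, P x = Q x + lam • x)
    (f : I.Quot → C) (t : BWord Z) :
    evalIn P f t - evalIn Q f t ∈ evalSpan Q f t.brCount := by
  have hmem : ∀ t, evalIn Q f t ∈ evalSpan Q f (t.brCount + 1) := fun t =>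
    Submodule.subset_span ⟨t, Nat.lt_succ_self _, rfl⟩
  have hmem' : ∀ t, evalIn P f t - evalIn Q f t ∈ evalSpan Q f t.brCount →
      evalIn P f t ∈ evalSpan Q f (t.brCount + 1) := fun t ht => by
    have := add_mem (evalSpan_mono _ _ (Nat.le_succ _) ht) (hmem t)
    rwa [sub_add_cancel] at this
  have hmul : ∀ s t, evalIn P f s - evalIn Q f s ∈ evalSpan Q f s.brCount →
      evalIn P f t - evalIn Q f t ∈ evalSpan Q f t.brCount →
      evalIn P f (s * t) - evalIn Q f (s * t) ∈ evalSpan Q f (s * t).brCount := by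
    intro s t hs ht
    have h : evalIn P f (s * t) - evalIn Q f (s * t) =
        (evalIn P f s - evalIn Q f s) * evalIn P f t
          + evalIn Q f s * (evalIn P f t - evalIn Q f t) := by
      rw [evalIn_mul, evalIn_mul]; noncomm_ring
    rw [h, BWord.brCount_mul]
    exact add_mem (mul_mem_evalSpan hs (hmem' t ht) (by omega))
      (mul_mem_evalSpan (hmem s) ht (by omega))
  have hvar : ∀ z, evalIn P f (BWord.var z) - evalIn Q f (BWord.var z)
      ∈ evalSpan Q f (BWord.var z).brCount := fun z => by
    change f _ - f _ ∈ _
    rw [sub_self]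
    exact zero_mem _
  have hbr : ∀ s, evalIn P f s - evalIn Q f s ∈ evalSpan Q f s.brCount →
      evalIn P f s.br - evalIn Q f s.br ∈ evalSpan Q f s.br.brCount := by
    intro s hs
    have h : evalIn P f s.br - evalIn Q f s.br =
        Q (evalIn P f s - evalIn Q f s) + lam • evalIn P f s := by
      rw [evalIn_br, evalIn_br, hPQ, map_sub]; abel
    rw [h]
    refine add_mem ?_ (Submodule.smul_mem _ _ (hmem' s hs))
    refine linear_mem_of_span Q ?_ hs
    rintro _ ⟨t, ht, rfl⟩
    exact Submodule.subset_span ⟨t.br, Nat.succ_lt_succ ht, rfl⟩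
  induction t with
  | var z => exact hvar z
  | br s ih => exact hbr s ih
  | varCons z s ih => exact hmul (BWord.var z) s (hvar z) ih
  | brCons s s' ih ih' => exact hmul s.br s' (hbr s ih) ih'

end Triangular

/-! ### The first group of identities -/

section FirstGroup

variable {k : Type u} [Field k] {Z : Type v} [LinearOrder Z] [WellFoundedLT Z]
  {G : Set (WordAlg k Z)} {I : AlgIdeal k (WordAlg k Z)}

/-- The `φ`-algebras are the operated algebras `(C, P)` such that `Q = P - lam` satisfies
`Q(x)Q(y) = c Q(xy)`, or `Q(x)Q(y) = c Q(yx)`. -/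
def IsShiftedHomOPI (φ : OPI k) (lam c : k) (σ : Bool) : Prop :=
  ∀ {C : Type (max u v)} [NonUnitalRing C] [Module k C] [IsScalarTower k C C] [SMulCommClass k C C]
    (P : C →ₗ[k] C), IsPhiAlgebra φ P ↔
      ∀ x y, (P x - lam • x) * (P y - lam • y) = c • (P (tw σ x y) - lam • tw σ x y)

/-- Expanding the shifted identity produces `lam ^ 2 - lam * mu` as the coefficient of `xy`; the
hypothesis says that this is `nu`. -/
theorem isShiftedHomOPI_opiN1a {lam mu nu : k} (h : lam ^ 2 = lam * mu + nu) :
    IsShiftedHomOPI.{u, v} (opiN1a lam mu nu) lam (-mu) true := by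
  intro C _ _ _ _ P
  obtain rfl : nu = lam ^ 2 - lam * mu := by rw [h]; ring
  have key : ∀ x y : C, P x * P y - lam • (x * P y + P x * y) + mu • P (x * y)
      + (lam ^ 2 - lam * mu) • (x * y) =
      (P x - lam • x) * (P y - lam • y) - (-mu) • (P (x * y) - lam • (x * y)) := by
    intro x y
    simp only [sub_mul, mul_sub, smul_mul_assoc, mul_smul_comm]
    module
  constructor
  · intro hP x y
    have := hP ![x, y]
    rw [← evalHom_eq, evalHom_opiN1a, key, sub_eq_zero] at this
    exact this
  · intro hP r
    rw [← evalHom_eq, evalHom_opiN1a, key, sub_eq_zero]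
    exact hP _ _

/-- Here `xy` and `yx` are separate monomials, and their coefficients in the identity already are
those of the expansion, so no constraint on the parameters remains. -/
theorem isShiftedHomOPI_opiN2a (lam mu : k) :
    IsShiftedHomOPI.{u, v} (opiN2a lam mu) lam (-mu) false := by
  intro C _ _ _ _ P
  have key : ∀ x y : C, P x * P y - lam • (x * P y + P x * y) + mu • P (y * x)
      + lam ^ 2 • (x * y) - (lam * mu) • (y * x) =
      (P x - lam • x) * (P y - lam • y) - (-mu) • (P (y * x) - lam • (y * x)) := by
    intro x y
    simp only [sub_mul, mul_sub, smul_mul_assoc, mul_smul_comm]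
    module
  constructor
  · intro hP x y
    have := hP ![x, y]
    rw [← evalHom_eq, evalHom_opiN2a, key, sub_eq_zero] at this
    exact this
  · intro hP r
    rw [← evalHom_eq, evalHom_opiN2a, key, sub_eq_zero]
    exact hP _ _

/-- Spanning and independence are first obtained for words evaluated with `Q`, then carried to the
operator of the free algebra by triangularity in the number of brackets. -/
theorem isLinearBasis_of_isShiftedHom (hG : IsGSBasis G I) {φ : OPI k} {lam c : k} {σ : Bool}
    (hbil : IsBilinearOPI.{u, v} φ) (hφ : IsShiftedHomOPI.{u, v} φ lam c σ) :
    IsLinearBasis φ I (basis1 G) := by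
  have hA := span_letter_irrS G I (by rw [← hG.1]; exact subset_span G)
  set Q : FreePhiAlg φ I →ₗ[k] FreePhiAlg φ I := freeOp φ I - lam • LinearMap.id with hQdef
  have hQ : ∀ x y, Q x * Q y = c • Q (tw σ x y) := (hφ _).1 (isPhiAlgebra_freeOp I hbil)
  have hPQ : ∀ x, freeOp φ I x = Q x + lam • x := fun x => (sub_add_cancel _ _).symm
  have hindep : LinearIndependent k fun t : basis1 G =>
      evalIn Q (freeHom φ I) (t : BWord Z) := by
    -- A linear relation involves words of bounded depth, so a separate model for each `basisStep`
    -- is enough.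
    refine linearIndepOn_iUnion_of_directed (basisStep_mono.directed_le) fun n => ?_
    obtain ⟨D, _, _, _, _, QD, f, hQD, hind⟩ := exists_model hG c σ n
    have hPD : IsPhiAlgebra φ (QD + lam • LinearMap.id) := by
      rw [hφ]
      intro x y
      simp only [LinearMap.add_apply, LinearMap.smul_apply, LinearMap.id_apply, add_sub_cancel_right]
      exact hQD x y
    obtain ⟨g, hg1, hg2⟩ := exists_freeHom_lift φ I _ hPD f
    have hgQ : ∀ a, g (Q a) = QD (g a) := fun a => by
      have h1 : Q a = freeOp φ I a - lam • a := rfl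
      rw [h1, map_sub, hg1, map_smul]
      exact add_sub_cancel_right _ _
    refine LinearIndependent.of_comp (g : FreePhiAlg φ I →ₗ[k] D) ?_
    convert hind using 1
    funext t
    change g (evalIn Q (freeHom φ I) t.1) = _
    rw [evalIn, BWord.map_eval Q QD _ g (map_mul g) hgQ]
    simp only [hg2]
    rfl
  -- The difference involves arbitrary words with fewer brackets; rewriting these as alternating
  -- words does not increase the number of brackets, so the change is triangular within `basis1 G`.
  have htri : ∀ t : basis1 G, wordClass φ I t - evalIn Q (freeHom φ I) (t : BWord Z) ∈
      Submodule.span k ((fun t : basis1 G => evalIn Q (freeHom φ I) (t : BWord Z)) ''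
        {s | (s : BWord Z).brCount < (t : BWord Z).brCount}) := by
    intro t
    rw [wordClass_eq_eval]
    refine (Submodule.span_le.2 ?_) (evalIn_sub_mem_evalSpan hPQ (freeHom φ I) t.1)
    rintro _ ⟨s, hs, rfl⟩
    refine (Submodule.span_mono ?_) (evalIn_mem_altSpan_brCount hA hQ s)
    rintro _ ⟨s', ⟨hs', hle⟩, rfl⟩
    exact ⟨⟨s', hs'⟩, lt_of_le_of_lt hle hs, rfl⟩
  refine ⟨linearIndependent_of_triangular hindep htri, ?_⟩
  have hall : ∀ s, evalIn Q (freeHom φ I) s ∈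
      Submodule.span k (Set.range fun t : basis1 G => wordClass φ I t) := by
    intro s
    refine range_subset_span_of_triangular htri ?_
    refine (Submodule.span_mono ?_) (evalIn_mem_altSpan_brCount hA hQ s)
    rintro _ ⟨t, ⟨ht, -⟩, rfl⟩
    exact ⟨⟨t, ht⟩, rfl⟩
  rw [eq_top_iff, ← span_wordClass φ I, Submodule.span_le]
  rintro _ ⟨s, rfl⟩
  have h1 : evalSpan Q (freeHom φ I) s.brCount ≤
      Submodule.span k (Set.range fun t : basis1 G => wordClass φ I t) := by
    refine Submodule.span_le.2 ?_
    rintro _ ⟨t, -, rfl⟩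
    exact hall t
  have h2 := add_mem (h1 (evalIn_sub_mem_evalSpan hPQ (freeHom φ I) s)) (hall s)
  rw [sub_add_cancel] at h2
  rw [wordClass_eq_eval]
  exact h2

end FirstGroup

end OpAlg

/-! ### Assembly of the three groups of identities. -/

open OpAlg
theorem mainTheorem5 {k : Type u} [Field k] {Z : Type v} [LinearOrder Z] [WellFoundedLT Z]
    (I : AlgIdeal k (WordAlg k Z)) (G : Set (WordAlg k Z)) (hG : IsGSBasis G I) :
    (∀ φ : OPI k, IsPhi1 φ →
      IsFreePhiAlgebra.{u, max u v, w} φ (freeOp φ I) (freeHom φ I) ∧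
        IsLinearBasis φ I (basis1 G)) ∧
    (∀ φ : OPI k, IsPhi2 φ →
      IsFreePhiAlgebra.{u, max u v, w} φ (freeOp φ I) (freeHom φ I) ∧
        IsLinearBasis φ I (basis2 G)) ∧
    (∀ φ : OPI k, IsPhi3 φ →
      IsFreePhiAlgebra.{u, max u v, w} φ (freeOp φ I) (freeHom φ I) ∧
        IsLinearBasis φ I (basis3 G)) := by
  refine ⟨?_, ?_, ?_⟩
  · rintro φ (⟨lam, mu, nu, h, rfl⟩ | ⟨lam, mu, rfl⟩)
    · exact ⟨isFreePhiAlgebra_of_isBilinear I (isBilinearOPI_opiN1a lam mu nu),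
        isLinearBasis_of_isShiftedHom hG (isBilinearOPI_opiN1a lam mu nu)
          (isShiftedHomOPI_opiN1a h)⟩
    · exact ⟨isFreePhiAlgebra_of_isBilinear I (isBilinearOPI_opiN2a lam mu),
        isLinearBasis_of_isShiftedHom hG (isBilinearOPI_opiN2a lam mu)
          (isShiftedHomOPI_opiN2a lam mu)⟩
  · rintro φ (⟨lam, rfl⟩ | rfl)
    · exact ⟨isFreePhiAlgebra_of_isBilinear I (isBilinearOPI_opiN1b lam),
        isLinearBasis_opiN1b hG lam⟩
    · exact ⟨isFreePhiAlgebra_of_isBilinear I isBilinearOPI_opiN3, isLinearBasis_opiN3 hG⟩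
  · rintro φ rfl
    exact ⟨isFreePhiAlgebra_of_isBilinear I isBilinearOPI_opiN4, isLinearBasis_opiN4 hG⟩
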